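/- Let $\mathbb D=\{z\in\mathbb C:|z|<1\}$ and $\rho(z,\zeta)=\left|\frac{z-\zeta}{1-\bar\zeta z}\right|$. Let $\phi:\mathbb D\to[0,\infty)$ be a weight, i.e. a function such that (wd1) there is $K>0$ with $\phi(z)\ge K\ln\frac1{1-|z|}$ for all $z\in\mathbb D$; (wd2) there are constants $0<r<1$, $D_0>0$, $E_0>0$ such that $\phi(z)\le D_0\phi(\zeta)+E_0$ whenever $z,\zeta\in\mathbb D$ and $\rho(z,\zeta)\le r$ (for instance $\phi(z)=\ln\frac1{1-|z|}$). Let $A_\phi$ be the algebra of holomorphic functions $f$ on $\mathbb D$ such that $\sup_{z\in\mathbb D}|f(z)|e^{-B\phi(z)}<\infty$ for some $B>0$ (for $\phi(z)=\ln\frac1{1-|z|}$ this is the Korenblum algebra $A^{-\infty}$). Let $\Lambda\subset\mathbb D$ be discrete, i.e. without accumulation points in $\mathbb D$. Write $\mathcal R_\Lambda(A_\phi)=\{f|_\Lambda: f\in A_\phi\}$. A discrete set $\Gamma\subset\mathbb D$ (possibly empty or finite) is called an interpolating sequence for $A_\phi$ if for every $\omega:\Gamma\to\mathbb C$ such that $|\omega(\gamma)|\le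 Ae^{B\phi(\gamma)}$ on $\Gamma$ for some $A,B>0$ there is $f\in A_\phi$ with $f|_\Gamma=\omega$. For $\omega:\Lambda\to\mathbb C$ and distinct points of $\Lambda$ put $\Delta^0\omega(\lambda_1)=\omega(\lambda_1)$ and, for $j\ge1$, $$\Delta^j\omega(\lambda_1,\dots,\lambda_{j+1})=\frac{\Delta^{j-1}\omega(\lambda_2,\dots,\lambda_{j+1})-\Delta^{j-1}\omega(\lambda_1,\dots,\lambda_j)}{\lambda_{j+1}-\lambda_1}.$$ The hyperbolic divided differences are $\delta^0\omega(\lambda_1)=\omega(\lambda_1)$ and, for $j\ge1$, $$\delta^j\omega(\lambda_1,\dots,\lambda_{j+1})=\frac{\Delta^{j-1}\omega(\lambda_2,\dots,\lambda_{j+1})-\Delta^{j-1}\omega(\lambda_1,\dots,\lambda_j)}{\dfrac{\lambda_{j+1}-\lambda_1}{1-\bar\lambda_1\lambda_{j+1}}}.$$ For $n\ge1$ let $X^{n-1}_\phi(\Lambda)$ be the space of all $\omega:\Lambda\to\mathbb C$ such that, for some $B>0$, $$\sup|\delta^{n-1}\omega(\lambda_1,\dots,\lambda_n)|\,e^{-B[\phi(\lambda_1)+\cdots+\phi(\lambda_n)]}<\infty,$$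 the supremum being over all $n$-tuples of pairwise distinct points of $\Lambda$. Then, for every integer $n\ge1$, the identity $\mathcal R_\Lambda(A_\phi)=X^{n-1}_\phi(\Lambda)$ holds if and only if $\Lambda$ is the union of $n$ interpolating sequences for $A_\phi$. -/

import Mathlib

/-- The pseudo-hyperbolic distance `|z - ζ| / |1 - conj ζ * z|` of the unit disk. -/
noncomputable def pseudoHypDist (z ζ : ℂ) : ℝ :=
  ‖(z - ζ) / (1 - (starRingEnd ℂ) ζ * z)‖

/-- Weights on the unit disk. Only the values of `φ` on the open unit disk matter.
The radius `r < 1` in `comparable` stands for "at bounded hyperbolic distance". -/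
structure IsDiskWeight (φ : ℂ → ℝ) : Prop where
  nonneg : ∀ z ∈ Metric.ball (0 : ℂ) 1, 0 ≤ φ z
  log_le : ∃ K : ℝ, 0 < K ∧ ∀ z ∈ Metric.ball (0 : ℂ) 1, K * Real.log (1 / (1 - ‖z‖)) ≤ φ z
  comparable : ∃ r D₀ E₀ : ℝ, 0 < r ∧ r < 1 ∧ 0 < D₀ ∧ 0 < E₀ ∧
    ∀ z ∈ Metric.ball (0 : ℂ) 1, ∀ ζ ∈ Metric.ball (0 : ℂ) 1,
      pseudoHypDist z ζ ≤ r → φ z ≤ D₀ * φ ζ + E₀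

/-- The algebra `A_φ` of holomorphic functions `f` on the unit disk such that
`|f| e^{-Bφ}` is bounded on the disk for some `B > 0`. -/
def korenblumAlgebra (φ : ℂ → ℝ) : Set (ℂ → ℂ) :=
  {f | DifferentiableOn ℂ f (Metric.ball (0 : ℂ) 1) ∧
    ∃ B : ℝ, 0 < B ∧ ∃ A : ℝ, ∀ z ∈ Metric.ball (0 : ℂ) 1,
      ‖f z‖ * Real.exp (-B * φ z) ≤ A}

/-- Discrete subsets of the unit disk: no accumulation point in the open disk. -/
def IsDiskDiscrete (Λ : Set ℂ) : Prop :=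
  Λ ⊆ Metric.ball (0 : ℂ) 1 ∧
    ∀ z ∈ Metric.ball (0 : ℂ) 1, ¬ AccPt z (Filter.principal Λ)

/-- The trace of `A_φ` on `Λ`: all restrictions to `Λ` of functions of `A_φ`. -/
def diskTrace (φ : ℂ → ℝ) (Λ : Set ℂ) : Set (Λ → ℂ) :=
  {ω | ∃ f ∈ korenblumAlgebra φ, ∀ l : Λ, f l = ω l}

/-- The space `A_φ(Λ)` of functions `ω` on `Λ` with `|ω| ≤ A e^{Bφ}` for some `A, B > 0`. -/
def growthSpace (φ : ℂ → ℝ) (Λ : Set ℂ) : Set (Λ → ℂ) :=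
  {ω | ∃ A B : ℝ, 0 < A ∧ 0 < B ∧ ∀ l : Λ, ‖ω l‖ ≤ A * Real.exp (B * φ l)}

/-- `Λ` is an interpolating sequence for `A_φ`. -/
def IsDiskInterpolating (φ : ℂ → ℝ) (Λ : Set ℂ) : Prop :=
  IsDiskDiscrete Λ ∧ ∀ ω ∈ growthSpace φ Λ, ∃ f ∈ korenblumAlgebra φ, ∀ l : Λ, f l = ω l

/-- The divided differences `Δ^j ω(λ₁, …, λ_{j+1})`. -/
noncomputable def dividedDiff {Λ : Set ℂ} (ω : Λ → ℂ) : (j : ℕ) → (Fin (j + 1) → Λ) → ℂ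
  | 0, v => ω (v 0)
  | j + 1, v =>
      (dividedDiff ω j (Fin.tail v) - dividedDiff ω j (Fin.init v)) /
        ((v (Fin.last (j + 1)) : ℂ) - (v 0 : ℂ))

/-- The hyperbolic divided differences `δ^j ω(λ₁, …, λ_{j+1})`: the last quotient is taken with
the hyperbolic factor `(λ_{j+1} - λ₁) / (1 - conj λ₁ * λ_{j+1})`, and the numerator is formed
with the divided differences `Δ^{j-1}`. -/
noncomputable def hypDividedDiff {Λ : Set ℂ} (ω : Λ → ℂ) : (j : ℕ) → (Fin (j + 1) → Λ) → ℂ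
  | 0, v => ω (v 0)
  | j + 1, v =>
      (dividedDiff ω j (Fin.tail v) - dividedDiff ω j (Fin.init v)) /
        (((v (Fin.last (j + 1)) : ℂ) - (v 0 : ℂ)) /
          (1 - (starRingEnd ℂ) (v 0 : ℂ) * (v (Fin.last (j + 1)) : ℂ)))

/-- The space `X^j_φ(Λ)`: functions on `Λ` whose hyperbolic divided differences of order `j`,
at tuples of `j + 1` distinct points, are bounded with respect to the weight `φ`. -/
def hypDiffSpace (φ : ℂ → ℝ) (Λ : Set ℂ) (j : ℕ) : Set (Λ → ℂ) :=
  {ω | ∃ B : ℝ, 0 < B ∧ ∃ A : ℝ, ∀ v : Fin (j + 1) → Λ, Function.Injective v →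
    ‖hypDividedDiff ω j v‖ * Real.exp (-B * ∑ i, φ (v i)) ≤ A}

/-! Put ψ = φ + 1. The two weight axioms say that, for suitable K and D, the Euclidean disk of
radius exp(-Kψ(a)) about `a` lies in the unit disk and ψ varies there by at most a factor D.
Everything happens at this scale: constants are absorbed by ψ ≥ 1, and the hyperbolic factor 1 -
conj λ₁ λₙ lies between exp(-Kψ(λ₁)) and 2, so ordinary divided differences, viewed as symmetric
functions of finite sets, can replace hyperbolic ones.

Traces always have controlled differences: a divided difference of f on a set containing `a` is one
of the difference quotient `dslope f a` on the remaining points, and the Schwarz lemma bounds this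
quotient (`norm_finsetDividedDiff_le`).

Union of n interpolating sets ⇒ equality (`exists_interpolation_iUnion`): by induction, make the
data w vanish on all sets but the last. For γ in the last set there is a function vanishing on the
others whose value at γ is the product of γ - μ over at most n - 1 nearby points μ. The quotient of
w(γ) by this product is exactly a divided difference, hence controlled. Multiplying by functions
that peak at γ on the last set and summing over γ gives the interpolant; separation makes the sum
converge.

Equality ⇒ union (`exists_iUnion_isGaugeInterpolating`): data at l of the size of the product of
distances to its fewer than n nearest neighbours T(l) lie in X, so they are interpolated, with
uniform growth by a Baire argument. Divided differences of the interpolant of a peak at l show that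
every point outside T(l) is far from l. The graph of close pairs then has degree less than n, so n
colours suffice. Each colour class is separated, and is interpolating because the zeros of a peak at
the other colours can be divided out. -/

/-! ### Divided differences at finite sets -/

/-- The divided difference of `w` at a finite set of points, in symmetric form. -/
noncomputable def finsetDividedDiff (w : ℂ → ℂ) (s : Finset ℂ) : ℂ :=
  ∑ i ∈ s, w i * ∏ k ∈ s.erase i, (i - k)⁻¹

theorem finsetDividedDiff_singleton (w : ℂ → ℂ) (a : ℂ) : finsetDividedDiff w {a} = w a := by
  simp [finsetDividedDiff]

theorem finsetDividedDiff_congr {w w' : ℂ → ℂ} {s : Finset ℂ} (h : ∀ i ∈ s, w i = w' i) :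
    finsetDividedDiff w s = finsetDividedDiff w' s :=
  Finset.sum_congr rfl fun i hi => by rw [h i hi]

theorem finsetDividedDiff_sub (w w' : ℂ → ℂ) (s : Finset ℂ) :
    finsetDividedDiff (fun z => w z - w' z) s = finsetDividedDiff w s - finsetDividedDiff w' s := by
  simp [finsetDividedDiff, sub_mul]

theorem finsetDividedDiff_insert (w : ℂ → ℂ) {a : ℂ} {s : Finset ℂ} (ha : a ∉ s) :
    finsetDividedDiff w (insert a s) =
      w a * ∏ k ∈ s, (a - k)⁻¹ + ∑ i ∈ s, (i - a)⁻¹ * (w i * ∏ k ∈ s.erase i, (i - k)⁻¹) := by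
  rw [finsetDividedDiff, Finset.sum_insert ha, Finset.erase_insert ha]
  congr 1
  refine Finset.sum_congr rfl fun i hi => ?_
  have hia : a ≠ i := fun h => ha (h ▸ hi)
  rw [Finset.erase_insert_of_ne hia, Finset.prod_insert (by simp [ha])]
  ring

theorem finsetDividedDiff_insert_of_eq_zero {w : ℂ → ℂ} {a : ℂ} {s : Finset ℂ} (ha : a ∉ s)
    (h : ∀ i ∈ s, w i = 0) :
    finsetDividedDiff w (insert a s) = w a * ∏ k ∈ s, (a - k)⁻¹ := by
  rw [finsetDividedDiff_insert w ha, Finset.sum_eq_zero fun i hi => by simp [h i hi], add_zero]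

theorem finsetDividedDiff_insert_sub_insert (w : ℂ → ℂ) {a b : ℂ} {s : Finset ℂ} (hab : a ≠ b)
    (ha : a ∉ s) (hb : b ∉ s) :
    finsetDividedDiff w (insert b s) - finsetDividedDiff w (insert a s) =
      (b - a) * finsetDividedDiff w (insert a (insert b s)) := by
  have hab' : a ∉ insert b s := by simp [hab, ha]
  have hne : b - a ≠ 0 := sub_ne_zero.2 hab.symm
  have hne' : a - b ≠ 0 := sub_ne_zero.2 hab
  rw [finsetDividedDiff_insert w hab', Finset.prod_insert hb, Finset.sum_insert hb,
    Finset.erase_insert hb, finsetDividedDiff_insert w ha, finsetDividedDiff_insert w hb,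
    mul_add, mul_add, Finset.mul_sum]
  have key : ∀ i ∈ s, (b - a) * ((i - a)⁻¹ * (w i * ∏ k ∈ (insert b s).erase i, (i - k)⁻¹)) =
      (i - b)⁻¹ * (w i * ∏ k ∈ s.erase i, (i - k)⁻¹) -
        (i - a)⁻¹ * (w i * ∏ k ∈ s.erase i, (i - k)⁻¹) := by
    intro i hi
    have h1 : i - a ≠ 0 := sub_ne_zero.2 fun h => ha (h ▸ hi)
    have h2 : i - b ≠ 0 := sub_ne_zero.2 fun h => hb (h ▸ hi)
    rw [Finset.erase_insert_of_ne (fun h : b = i => hb (h ▸ hi)), Finset.prod_insert (by simp [hb])]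
    field_simp
    ring
  rw [Finset.sum_congr rfl key, Finset.sum_sub_distrib]
  have e1 : (b - a) * (w a * ((a - b)⁻¹ * ∏ k ∈ s, (a - k)⁻¹)) = - (w a * ∏ k ∈ s, (a - k)⁻¹) := by
    field_simp
    ring
  have e2 : (b - a) * ((b - a)⁻¹ * (w b * ∏ k ∈ s, (b - k)⁻¹)) = w b * ∏ k ∈ s, (b - k)⁻¹ := by
    field_simp
  rw [e1, e2]
  ring

/-- The exchange identity writes b - a times the difference as the difference of two equal values,
both c in the base case and both 0 by induction afterwards. -/
theorem finsetDividedDiff_const {s : Finset ℂ} (hs : 2 ≤ s.card) (c : ℂ) :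
    finsetDividedDiff (fun _ => c) s = 0 := by
  obtain ⟨m, hm⟩ := Nat.exists_eq_add_of_le hs
  clear hs
  induction m generalizing s with
  | zero =>
    obtain ⟨a, b, hab, rfl⟩ := Finset.card_eq_two.1 hm
    have h := finsetDividedDiff_insert_sub_insert (fun _ => c) (s := ∅) hab (by simp) (by simp)
    simp only [insert_empty_eq, finsetDividedDiff_singleton, sub_self] at h
    exact (mul_eq_zero.1 h.symm).resolve_left (sub_ne_zero.2 hab.symm)
  | succ m ih =>
    obtain ⟨a, t, ha, rfl, ht⟩ := Finset.card_eq_succ.1 (show s.card = (2 + m) + 1 by omega)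
    obtain ⟨b, u, hb, rfl, hu⟩ := Finset.card_eq_succ.1 (show t.card = (1 + m) + 1 by omega)
    have hab : a ≠ b := fun h => ha (by simp [h])
    have ha' : a ∉ u := fun h => ha (by simp [h])
    have h := finsetDividedDiff_insert_sub_insert (fun _ => c) hab ha' hb
    rw [ih ht, ih (s := insert a u) (by rw [Finset.card_insert_of_notMem ha']; omega),
      sub_self] at h
    exact (mul_eq_zero.1 h.symm).resolve_left (sub_ne_zero.2 hab.symm)

/-- Subtracting the constant f(a) changes nothing on a set of at least two points. It removes the
term at `a` and turns the remaining ones into slopes based at `a`. -/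
theorem finsetDividedDiff_insert_eq_dslope (f : ℂ → ℂ) {a : ℂ} {s : Finset ℂ} (ha : a ∉ s)
    (hs : s.Nonempty) :
    finsetDividedDiff f (insert a s) = finsetDividedDiff (dslope f a) s := by
  have h0 : finsetDividedDiff (fun _ => f a) (insert a s) = 0 :=
    finsetDividedDiff_const (by
      rw [Finset.card_insert_of_notMem ha]
      have := hs.card_pos
      omega) _
  have h1 := finsetDividedDiff_sub f (fun _ => f a) (insert a s)
  rw [h0, sub_zero] at h1
  rw [← h1, finsetDividedDiff_insert _ ha, sub_self, zero_mul, zero_add, finsetDividedDiff]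
  refine Finset.sum_congr rfl fun i hi => ?_
  have hia : i ≠ a := fun h => ha (h ▸ hi)
  rw [dslope_of_ne _ hia, slope_def_field]
  ring

theorem norm_finsetDividedDiff_le_sum (w : ℂ → ℂ) (s : Finset ℂ) :
    ‖finsetDividedDiff w s‖ ≤ ∑ i ∈ s, ‖w i‖ * ∏ k ∈ s.erase i, ‖i - k‖⁻¹ := by
  refine (norm_sum_le _ _).trans (Finset.sum_le_sum fun i _ => ?_)
  simp [norm_prod, norm_inv]

/-- The tail and the initial part of a tuple share the middle points and differ in one end point, so
the recursion is the exchange identity `finsetDividedDiff_insert_sub_insert`. -/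
theorem dividedDiff_eq_finsetDividedDiff {Λ : Set ℂ} {ω : Λ → ℂ} {w : ℂ → ℂ}
    (hw : ∀ l : Λ, w l = ω l) (j : ℕ) (v : Fin (j + 1) → Λ) (hv : Function.Injective v) :
    dividedDiff ω j v = finsetDividedDiff w (Finset.univ.image fun i => (v i : ℂ)) := by
  induction j with
  | zero => simp [dividedDiff, finsetDividedDiff_singleton, hw]
  | succ j ih =>
    have htail : Function.Injective (Fin.tail v) := fun a b h => Fin.succ_injective _ (hv h)
    have hinit : Function.Injective (Fin.init v) := fun a b h => Fin.castSucc_injective _ (hv h)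
    rw [dividedDiff, ih _ htail, ih _ hinit]
    have hvc : Function.Injective fun i => (v i : ℂ) := Subtype.val_injective.comp hv
    set a : ℂ := ((v 0 : Λ) : ℂ) with ha
    set b : ℂ := ((v (Fin.last (j + 1)) : Λ) : ℂ) with hb
    set s : Finset ℂ := Finset.univ.image fun i : Fin j => (v i.succ.castSucc : ℂ) with hs
    have hab : a ≠ b := fun h => by
      have := hvc h
      simp [Fin.ext_iff] at this
    have has : a ∉ s := by
      simp only [hs, Finset.mem_image, Finset.mem_univ, true_and, not_exists]
      intro i h
      have := hvc h
      simp [Fin.ext_iff] at this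
    have hbs : b ∉ s := by
      simp only [hs, Finset.mem_image, Finset.mem_univ, true_and, not_exists]
      intro i h
      have := hvc h
      simp [Fin.ext_iff] at this
      omega
    have e1 : (Finset.univ.image fun i => (Fin.tail v i : ℂ)) = insert b s := by
      ext x
      simp only [Finset.mem_image, Finset.mem_univ, true_and, Finset.mem_insert, hs, hb, Fin.tail]
      rw [Fin.exists_fin_succ']
      simp [eq_comm, or_comm]
    have e2 : (Finset.univ.image fun i => (Fin.init v i : ℂ)) = insert a s := by
      ext x
      simp only [Finset.mem_image, Finset.mem_univ, true_and, Finset.mem_insert, hs, ha, Fin.init]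
      rw [Fin.exists_fin_succ]
      simp [eq_comm]
    have e3 : (Finset.univ.image fun i => (v i : ℂ)) = insert a (insert b s) := by
      rw [← e1]
      ext x
      simp only [Finset.mem_image, Finset.mem_univ, true_and, Finset.mem_insert, ha, Fin.tail]
      rw [Fin.exists_fin_succ]
      simp [eq_comm]
    rw [e1, e2, e3, finsetDividedDiff_insert_sub_insert w hab has hbs,
      mul_div_cancel_left₀ _ (sub_ne_zero.2 hab.symm)]

-- Gauges on the disk and bounds for difference quotients

local notation "𝔻" => Metric.ball (0 : ℂ) 1

/-- A weight `ψ ≥ 1` on the unit disk that is essentially constant on the disks with centre `a`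
and radius `exp (-K * ψ a)`, these disks being contained in the unit disk. -/
structure IsDiskGauge (ψ : ℂ → ℝ) (K D : ℝ) : Prop where
  pos : 0 < K
  one_le_const : 1 ≤ D
  one_le : ∀ z ∈ 𝔻, 1 ≤ ψ z
  exp_le : ∀ z ∈ 𝔻, Real.exp (-K * ψ z) ≤ 1 - ‖z‖
  le_mul : ∀ a ∈ 𝔻, ∀ z ∈ 𝔻, ‖z - a‖ < Real.exp (-K * ψ a) → ψ z ≤ D * ψ a
  le_mul' : ∀ a ∈ 𝔻, ∀ z ∈ 𝔻, ‖z - a‖ < Real.exp (-K * ψ a) → ψ a ≤ D * ψ z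

/-- `f` is holomorphic on the unit disk and `‖f‖ ≤ exp (N * ψ)` there. -/
def HasDiskGrowth (ψ : ℂ → ℝ) (N : ℝ) (f : ℂ → ℂ) : Prop :=
  DifferentiableOn ℂ f 𝔻 ∧ ∀ z ∈ 𝔻, ‖f z‖ ≤ Real.exp (N * ψ z)

theorem pseudoHypDist_comm (z w : ℂ) : pseudoHypDist z w = pseudoHypDist w z := by
  have h : 1 - (starRingEnd ℂ) z * w = (starRingEnd ℂ) (1 - (starRingEnd ℂ) w * z) := by
    simp [mul_comm]
  rw [pseudoHypDist, pseudoHypDist, norm_div, norm_div, norm_sub_rev, h, RCLike.norm_conj]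

theorem one_sub_norm_le_norm_one_sub_conj_mul {a z : ℂ} (hz : z ∈ 𝔻) :
    1 - ‖a‖ ≤ ‖1 - (starRingEnd ℂ) a * z‖ := by
  have hz' : ‖z‖ < 1 := by simpa using hz
  have h1 : ‖(1 : ℂ)‖ - ‖(starRingEnd ℂ) a * z‖ ≤ ‖1 - (starRingEnd ℂ) a * z‖ :=
    norm_sub_norm_le _ _
  rw [norm_one, norm_mul, RCLike.norm_conj] at h1
  nlinarith [norm_nonneg a]

theorem pseudoHypDist_le_of_norm_sub_le {a z : ℂ} {r : ℝ} (ha : a ∈ 𝔻) (hz : z ∈ 𝔻) (hr : 0 ≤ r)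
    (h : ‖z - a‖ ≤ r * (1 - ‖a‖)) : pseudoHypDist z a ≤ r := by
  have ha' : ‖a‖ < 1 := by simpa using ha
  have h1 := one_sub_norm_le_norm_one_sub_conj_mul (a := a) hz
  rw [pseudoHypDist, norm_div, div_le_iff₀ (by linarith)]
  exact h.trans (mul_le_mul_of_nonneg_left h1 hr)

theorem IsDiskWeight.exists_isDiskGauge {φ : ℂ → ℝ} (hφ : IsDiskWeight φ) :
    ∃ K D : ℝ, IsDiskGauge (fun z => φ z + 1) K D := by
  obtain ⟨k, hk, hlog⟩ := hφ.log_le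
  obtain ⟨r, D₀, E₀, hr, hr1, hD, hE, hcomp⟩ := hφ.comparable
  have hL : 0 < -Real.log r := neg_pos.2 (Real.log_neg hr hr1)
  -- The term 1/k turns the logarithmic lower bound into a factor 1 - ‖z‖, and -log r, with ψ ≥ 1,
  -- supplies the factor r that makes the disk pseudo-hyperbolically small.
  have hkey : ∀ z ∈ 𝔻, Real.exp (-(1 / k + -Real.log r) * (φ z + 1)) ≤ r * (1 - ‖z‖) := by
    intro z hz
    have hz' : 0 < 1 - ‖z‖ := by simpa using hz
    have h0 := hφ.nonneg z hz
    have h1 := hlog z hz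
    rw [one_div, Real.log_inv] at h1
    rw [← Real.exp_log (mul_pos hr hz'), Real.exp_le_exp, Real.log_mul hr.ne' hz'.ne']
    have h2 : -Real.log (1 - ‖z‖) ≤ 1 / k * φ z := by
      rw [one_div, ← div_eq_inv_mul, le_div_iff₀ hk]
      linarith
    have h3 : 0 ≤ 1 / k := by positivity
    nlinarith
  have hcomp' : ∀ a ∈ 𝔻, ∀ z ∈ 𝔻,
      ‖z - a‖ < Real.exp (-(1 / k + -Real.log r) * (φ a + 1)) → pseudoHypDist z a ≤ r :=
    fun a ha z hz h => pseudoHypDist_le_of_norm_sub_le ha hz hr.le (h.le.trans (hkey a ha))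
  refine ⟨1 / k + -Real.log r, D₀ + E₀ + 1, ⟨by positivity, by linarith, ?_, ?_, ?_, ?_⟩⟩
  · intro z hz
    linarith [hφ.nonneg z hz]
  · intro z hz
    have hz' : 0 < 1 - ‖z‖ := by simpa using hz
    exact (hkey z hz).trans (by nlinarith)
  · intro a ha z hz h
    have := hcomp z hz a ha (hcomp' a ha z hz h)
    have := hφ.nonneg a ha
    nlinarith
  · intro a ha z hz h
    have := hcomp a ha z hz (by rw [pseudoHypDist_comm]; exact hcomp' a ha z hz h)
    have := hφ.nonneg z hz
    nlinarith

namespace IsDiskGauge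

variable {ψ : ℂ → ℝ} {K D : ℝ}

theorem mem_of_norm_sub_lt (hψ : IsDiskGauge ψ K D) {a z : ℂ} (ha : a ∈ 𝔻)
    (h : ‖z - a‖ < Real.exp (-K * ψ a)) : z ∈ 𝔻 := by
  have h1 := hψ.exp_le a ha
  have h2 : ‖z‖ ≤ ‖z - a‖ + ‖a‖ := by simpa using norm_add_le (z - a) a
  simp only [Metric.mem_ball, dist_zero_right]
  linarith

theorem exp_le_norm_one_sub_conj_mul (hψ : IsDiskGauge ψ K D) {a z : ℂ} (ha : a ∈ 𝔻)
    (hz : z ∈ 𝔻) : Real.exp (-K * ψ a) ≤ ‖1 - (starRingEnd ℂ) a * z‖ :=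
  (hψ.exp_le a ha).trans (one_sub_norm_le_norm_one_sub_conj_mul hz)

theorem differentiableOn_dslope {f : ℂ → ℂ} (hf : DifferentiableOn ℂ f 𝔻) {a : ℂ} (ha : a ∈ 𝔻) :
    DifferentiableOn ℂ (dslope f a) 𝔻 :=
  (Complex.differentiableOn_dslope (Metric.isOpen_ball.mem_nhds ha)).2 hf

theorem norm_dslope_le_of_le_norm_sub (f : ℂ → ℂ) {a z : ℂ} {R : ℝ}
    (h : Real.exp (-R) ≤ ‖z - a‖) : ‖dslope f a z‖ ≤ ‖f z - f a‖ * Real.exp R := by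
  have hpos : 0 < ‖z - a‖ := (Real.exp_pos _).trans_le h
  have hne : z ≠ a := fun e => by simp [e] at hpos
  rw [dslope_of_ne _ hne, slope_def_field, norm_div, div_eq_mul_inv]
  gcongr
  rw [inv_le_comm₀ hpos (Real.exp_pos _), ← Real.exp_neg]
  exact h

/-- Schwarz lemma on the gauge disk, where ψ ≤ D ψ(a). -/
theorem norm_dslope_le_of_norm_sub_lt (hψ : IsDiskGauge ψ K D) {f : ℂ → ℂ}
    (hf : DifferentiableOn ℂ f 𝔻) {M N : ℝ} (hM : 0 ≤ M) (hN : 0 ≤ N)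
    (hb : ∀ z ∈ 𝔻, ‖f z‖ ≤ M * Real.exp (N * ψ z)) {a z : ℂ} (ha : a ∈ 𝔻)
    (h : ‖z - a‖ < Real.exp (-K * ψ a)) :
    ‖dslope f a z‖ ≤ 2 * M * Real.exp ((N * D + K) * ψ a) := by
  have hb' : ∀ w, ‖w - a‖ < Real.exp (-K * ψ a) → ‖f w‖ ≤ M * Real.exp (N * D * ψ a) := by
    intro w hw
    have hwD := hψ.mem_of_norm_sub_lt ha hw
    refine (hb w hwD).trans ?_
    rw [mul_assoc N D]
    gcongr
    exact hψ.le_mul a ha w hwD hw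
  have hmaps : Set.MapsTo f (Metric.ball a (Real.exp (-K * ψ a)))
      (Metric.closedBall (f a) (2 * M * Real.exp (N * D * ψ a))) := by
    intro w hw
    rw [Metric.mem_ball, dist_eq_norm] at hw
    rw [Metric.mem_closedBall, dist_eq_norm]
    have h1 := hb' w hw
    have h2 := hb' a (by simpa using Real.exp_pos _)
    linarith [norm_sub_le (f w) (f a)]
  have hdiff : DifferentiableOn ℂ f (Metric.ball a (Real.exp (-K * ψ a))) :=
    hf.mono fun w hw => hψ.mem_of_norm_sub_lt ha (by simpa [dist_eq_norm] using hw)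
  have := Complex.norm_dslope_le_div_of_mapsTo_ball hdiff hmaps
    (z := z) (by simpa [dist_eq_norm] using h)
  refine this.trans (le_of_eq ?_)
  rw [mul_div_assoc, ← Real.exp_sub]
  ring_nf

/-- The growth exponent N in z is preserved and the whole loss is a factor depending on `a`; this
allows iteration over the points of a finite set. -/
theorem norm_dslope_le (hψ : IsDiskGauge ψ K D) {f : ℂ → ℂ}
    (hf : DifferentiableOn ℂ f 𝔻) {M N : ℝ} (hM : 0 ≤ M) (hN : 0 ≤ N)
    (hb : ∀ z ∈ 𝔻, ‖f z‖ ≤ M * Real.exp (N * ψ z)) {a z : ℂ} (ha : a ∈ 𝔻) (hz : z ∈ 𝔻) :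
    ‖dslope f a z‖ ≤ 2 * M * Real.exp ((N * D + K) * ψ a) * Real.exp (N * ψ z) := by
  have hψa := hψ.one_le a ha
  have hψz := hψ.one_le z hz
  have hD := hψ.one_le_const
  have hK := hψ.pos
  rcases lt_or_ge ‖z - a‖ (Real.exp (-K * ψ a)) with h | h
  · refine (hψ.norm_dslope_le_of_norm_sub_lt hf hM hN hb ha h).trans ?_
    exact le_mul_of_one_le_right (by positivity) (Real.one_le_exp (by positivity))
  · refine (norm_dslope_le_of_le_norm_sub f (R := K * ψ a) (by rwa [← neg_mul])).trans ?_
    have h1 : ‖f z‖ ≤ M * (Real.exp (N * D * ψ a) * Real.exp (N * ψ z)) := by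
      refine (hb z hz).trans ?_
      gcongr
      exact le_mul_of_one_le_left (by positivity) (Real.one_le_exp (by positivity))
    have h2 : ‖f a‖ ≤ M * (Real.exp (N * D * ψ a) * Real.exp (N * ψ z)) := by
      refine (hb a ha).trans ?_
      gcongr
      refine le_trans ?_ (le_mul_of_one_le_right (by positivity) (Real.one_le_exp (by positivity)))
      rw [Real.exp_le_exp]
      nlinarith [mul_nonneg hN (zero_le_one.trans hψa)]
    calc ‖f z - f a‖ * Real.exp (K * ψ a)
        ≤ (2 * (M * (Real.exp (N * D * ψ a) * Real.exp (N * ψ z)))) * Real.exp (K * ψ a) := by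
          gcongr
          linarith [norm_sub_le (f z) (f a)]
      _ = _ := by
          rw [add_mul, Real.exp_add]
          ring

/-- In contrast to `norm_dslope_le`, the loss at `a` does not involve N; the price is N D² in place
of N in z. This independence is what later avoids a circular choice of constants in
`isGaugeInterpolating_of_nearest`. -/
theorem norm_dslope_le_of_eq_zero (hψ : IsDiskGauge ψ K D) {f : ℂ → ℂ}
    (hf : DifferentiableOn ℂ f 𝔻) {M N : ℝ} (hM : 0 ≤ M) (hN : 0 ≤ N)
    (hb : ∀ z ∈ 𝔻, ‖f z‖ ≤ M * Real.exp (N * ψ z)) {a z : ℂ} (ha : a ∈ 𝔻) (hz : z ∈ 𝔻)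
    (h0 : f a = 0) :
    ‖dslope f a z‖ ≤ 2 * M * Real.exp (K * ψ a) * Real.exp (N * D ^ 2 * ψ z) := by
  have hψa := hψ.one_le a ha
  have hψz := hψ.one_le z hz
  have hD := hψ.one_le_const
  have hK := hψ.pos
  rcases lt_or_ge ‖z - a‖ (Real.exp (-K * ψ a)) with h | h
  · refine (hψ.norm_dslope_le_of_norm_sub_lt hf hM hN hb ha h).trans ?_
    rw [mul_assoc (2 * M), ← Real.exp_add]
    gcongr
    have h1 := hψ.le_mul' a ha z hz h
    have h2 : N * D * ψ a ≤ N * D * (D * ψ z) := by gcongr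
    linarith
  · refine (norm_dslope_le_of_le_norm_sub f (R := K * ψ a) (by rwa [← neg_mul])).trans ?_
    rw [h0, sub_zero, mul_right_comm]
    gcongr
    refine (hb z hz).trans ?_
    have h3 : N * ψ z ≤ N * D ^ 2 * ψ z := by
      gcongr
      exact le_mul_of_one_le_right hN (one_le_pow₀ hD)
    calc M * Real.exp (N * ψ z) ≤ M * Real.exp (N * D ^ 2 * ψ z) := by gcongr
      _ ≤ _ := by
        gcongr
        linarith

end IsDiskGauge

theorem Real.two_le_exp {x : ℝ} (hx : 1 ≤ x) : 2 ≤ Real.exp x := by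
  linarith [Real.add_one_le_exp x]

/-- The divided differences of `w` at sets of `k` points of `Λ` are bounded with respect to the
weight `ψ`. -/
def HasDividedDiffGrowth (ψ : ℂ → ℝ) (Λ : Set ℂ) (k : ℕ) (w : ℂ → ℂ) : Prop :=
  ∃ B : ℝ, 0 ≤ B ∧ ∀ s : Finset ℂ, ↑s ⊆ Λ → s.card = k →
    ‖finsetDividedDiff w s‖ ≤ Real.exp (B * ∑ i ∈ s, ψ i)

namespace HasDiskGrowth

variable {ψ : ℂ → ℝ} {K D N N' : ℝ} {f g : ℂ → ℂ}

theorem zero (ψ : ℂ → ℝ) (N : ℝ) : HasDiskGrowth ψ N 0 :=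
  ⟨differentiableOn_const 0, fun z _ => by simpa using (Real.exp_pos _).le⟩

theorem mono (hψ : IsDiskGauge ψ K D) (hf : HasDiskGrowth ψ N f) (h : N ≤ N') :
    HasDiskGrowth ψ N' f := by
  refine ⟨hf.1, fun z hz => (hf.2 z hz).trans ?_⟩
  have := hψ.one_le z hz
  gcongr

theorem mul (hf : HasDiskGrowth ψ N f) (hg : HasDiskGrowth ψ N' g) :
    HasDiskGrowth ψ (N + N') (fun z => f z * g z) := by
  refine ⟨hf.1.mul hg.1, fun z hz => ?_⟩
  rw [norm_mul, add_mul, Real.exp_add]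
  exact mul_le_mul (hf.2 z hz) (hg.2 z hz) (norm_nonneg _) (Real.exp_pos _).le

theorem add (hψ : IsDiskGauge ψ K D) (hf : HasDiskGrowth ψ N f) (hg : HasDiskGrowth ψ N' g) :
    HasDiskGrowth ψ (max N N' + 1) (fun z => f z + g z) := by
  refine ⟨hf.1.add hg.1, fun z hz => ?_⟩
  have h1 := (hf.mono hψ (le_max_left N N')).2 z hz
  have h2 := (hg.mono hψ (le_max_right N N')).2 z hz
  have h3 := Real.two_le_exp (hψ.one_le z hz)
  rw [add_mul, Real.exp_add, one_mul]
  have h4 := mul_le_mul_of_nonneg_left h3 (Real.exp_pos (max N N' * ψ z)).le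
  linarith [norm_add_le (f z) (g z)]

theorem const_mul (hψ : IsDiskGauge ψ K D) (hf : HasDiskGrowth ψ N f) (c : ℂ) :
    HasDiskGrowth ψ (‖c‖ + N) (fun z => c * f z) := by
  refine ⟨hf.1.const_mul c, fun z hz => ?_⟩
  rw [norm_mul, add_mul, Real.exp_add]
  have h1 := hψ.one_le z hz
  have h2 : ‖c‖ ≤ Real.exp (‖c‖ * ψ z) := by
    have := Real.add_one_le_exp (‖c‖ * ψ z)
    nlinarith [norm_nonneg c]
  exact mul_le_mul h2 (hf.2 z hz) (norm_nonneg _) (Real.exp_pos _).le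

theorem neg (hf : HasDiskGrowth ψ N f) : HasDiskGrowth ψ N (fun z => -f z) :=
  ⟨hf.1.neg, fun z hz => by simpa using hf.2 z hz⟩

end HasDiskGrowth

/-! ### Divided differences of functions of given growth; compactness and uniformity -/

namespace IsDiskGauge

variable {ψ : ℂ → ℝ} {K D : ℝ}

theorem norm_finsetDividedDiff_le (hψ : IsDiskGauge ψ K D) {N : ℝ} (hN : 0 ≤ N) (k : ℕ) :
    ∃ B : ℝ, 0 ≤ B ∧ ∀ M : ℝ, 0 ≤ M → ∀ f : ℂ → ℂ, DifferentiableOn ℂ f 𝔻 →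
      (∀ z ∈ 𝔻, ‖f z‖ ≤ M * Real.exp (N * ψ z)) → ∀ s : Finset ℂ, ↑s ⊆ 𝔻 → s.card = k →
        ‖finsetDividedDiff f s‖ ≤ M * Real.exp (B * ∑ i ∈ s, ψ i) := by
  have hK := hψ.pos
  have hD := hψ.one_le_const
  induction k with
  | zero =>
    refine ⟨0, le_rfl, fun M hM f _ _ s _ hs => ?_⟩
    rw [Finset.card_eq_zero] at hs
    subst hs
    simpa [finsetDividedDiff] using hM
  | succ k ih =>
    obtain ⟨B, hB, ih⟩ := ih
    refine ⟨N + B + (1 + N * D + K), by positivity, fun M hM f hf hb s hs hk => ?_⟩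
    obtain ⟨a, t, ha, rfl, ht⟩ := Finset.card_eq_succ.1 hk
    rw [Finset.coe_insert, Set.insert_subset_iff] at hs
    have hψa := hψ.one_le a hs.1
    rcases t.eq_empty_or_nonempty with rfl | hne
    · rw [insert_empty_eq, finsetDividedDiff_singleton, Finset.sum_singleton]
      refine (hb a hs.1).trans ?_
      gcongr
      linarith [show 0 ≤ N * D by positivity]
    · rw [finsetDividedDiff_insert_eq_dslope f ha hne, Finset.sum_insert ha]
      refine (ih (2 * M * Real.exp ((N * D + K) * ψ a)) (by positivity) _
        (differentiableOn_dslope hf hs.1)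
        (fun z hz => hψ.norm_dslope_le hf hM hN hb hs.1 hz) t hs.2 ht).trans ?_
      have hsum : 0 ≤ ∑ i ∈ t, ψ i :=
        Finset.sum_nonneg fun i hi => zero_le_one.trans (hψ.one_le i (hs.2 hi))
      calc 2 * M * Real.exp ((N * D + K) * ψ a) * Real.exp (B * ∑ i ∈ t, ψ i)
          ≤ Real.exp (ψ a) * M * Real.exp ((N * D + K) * ψ a) * Real.exp (B * ∑ i ∈ t, ψ i) := by
            gcongr
            exact Real.two_le_exp hψa
        _ = M * Real.exp (ψ a + (N * D + K) * ψ a + B * ∑ i ∈ t, ψ i) := by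
            rw [Real.exp_add, Real.exp_add]
            ring
        _ ≤ _ := by
            gcongr
            have h1 : 0 ≤ N * (ψ a + ∑ i ∈ t, ψ i) := by positivity
            have h2 : 0 ≤ B * ψ a := by positivity
            have h3 : 0 ≤ (1 + N * D + K) * ∑ i ∈ t, ψ i := by positivity
            nlinarith

theorem hasDividedDiffGrowth (hψ : IsDiskGauge ψ K D) {N : ℝ} (hN : 0 ≤ N) {f : ℂ → ℂ}
    (hf : HasDiskGrowth ψ N f) {Λ : Set ℂ} (hΛ : Λ ⊆ 𝔻) (k : ℕ) :
    HasDividedDiffGrowth ψ Λ k f := by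
  obtain ⟨B, hB, h⟩ := hψ.norm_finsetDividedDiff_le hN k
  refine ⟨B, hB, fun s hs hk => ?_⟩
  simpa using h 1 zero_le_one f hf.1 (by simpa using hf.2) s (hs.trans hΛ) hk

/-- Compactness of the set of holomorphic functions with a given growth, along ultrafilters. -/
theorem exists_tendsto_of_hasDiskGrowth (hψ : IsDiskGauge ψ K D) {N : ℝ} (hN : 0 ≤ N)
    {ι : Type*} (F : Ultrafilter ι) {f : ι → ℂ → ℂ} (hf : ∀ i, HasDiskGrowth ψ N (f i)) :
    ∃ g, HasDiskGrowth ψ N g ∧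
      ∀ z ∈ 𝔻, Filter.Tendsto (fun i => f i z) F (nhds (g z)) := by
  have hD := hψ.one_le_const
  have hK := hψ.pos
  have hlim : ∀ (R : ℝ) (u : ι → ℂ), (∀ i, ‖u i‖ ≤ R) →
      ∃ c, Filter.Tendsto u F (nhds c) := by
    intro R u hu
    obtain ⟨c, -, hc⟩ := (isCompact_closedBall (0 : ℂ) R).ultrafilter_le_nhds (F.map u)
      (Filter.le_principal_iff.2 (Filter.mem_map.2 (Filter.univ_mem' fun i => by simpa using hu i)))
    exact ⟨c, hc⟩
  have hex : ∀ z, ∃ c, z ∈ 𝔻 → Filter.Tendsto (fun i => f i z) F (nhds c) := by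
    intro z
    by_cases hz : z ∈ 𝔻
    · obtain ⟨c, hc⟩ := hlim _ _ fun i => (hf i).2 z hz
      exact ⟨c, fun _ => hc⟩
    · exact ⟨0, fun h => absurd h hz⟩
  choose g hg using hex
  refine ⟨g, ⟨fun a ha => ?_, fun z hz => ?_⟩, hg⟩
  · have h1 : ∀ i, ∀ z ∈ 𝔻, ‖dslope (f i) a z‖ ≤
        2 * 1 * Real.exp ((N * D + K) * ψ a) * Real.exp (N * ψ z) := fun i z hz =>
      hψ.norm_dslope_le (hf i).1 zero_le_one hN (by simpa using (hf i).2) ha hz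
    obtain ⟨c, hc⟩ := hlim _ (fun i => dslope (f i) a a) fun i => h1 i a ha
    -- The bound on the gauge disk applied to the quotient `dslope (f i) a`, itself bounded by `h1`:
    -- it controls the second-order Taylor remainder uniformly in i, so the pointwise limit is
    -- differentiable.
    set L := 2 * (2 * 1 * Real.exp ((N * D + K) * ψ a)) * Real.exp ((N * D + K) * ψ a) with hL
    have h2 : ∀ z, ‖z - a‖ < Real.exp (-K * ψ a) → ‖g z - g a - c * (z - a)‖ ≤
        L * ‖z - a‖ ^ 2 := by
      intro z hz
      have hzD := hψ.mem_of_norm_sub_lt ha hz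
      refine le_of_tendsto (((((hg z hzD).sub (hg a ha)).sub (hc.mul_const (z - a)))).norm)
        (Filter.Eventually.of_forall fun i => ?_)
      have e : f i z - f i a - dslope (f i) a a * (z - a) =
          dslope (dslope (f i) a) a z * (z - a) ^ 2 := by
        have e1 := sub_smul_dslope (f i) a z
        have e2 := sub_smul_dslope (dslope (f i) a) a z
        simp only [smul_eq_mul] at e1 e2
        rw [← e1, pow_two, ← mul_assoc, mul_comm (dslope (dslope (f i) a) a z), e2]
        ring
      rw [e, norm_mul, norm_pow]
      gcongr
      exact hψ.norm_dslope_le_of_norm_sub_lt (differentiableOn_dslope (hf i).1 ha) (by positivity)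
        hN (h1 i) ha hz
    have h3 : HasDerivAt g c a := by
      rw [hasDerivAt_iff_isLittleO]
      have hO : (fun z => g z - g a - (z - a) • c) =O[nhds a] fun z => (z - a) ^ 2 := by
        refine Asymptotics.IsBigO.of_bound L ?_
        filter_upwards [Metric.ball_mem_nhds a (Real.exp_pos (-K * ψ a))] with z hz
        rw [Metric.mem_ball, dist_eq_norm] at hz
        simpa [mul_comm] using h2 z hz
      refine hO.trans_isLittleO ?_
      have : (fun z : ℂ => z ^ 2) =o[nhds 0] fun z => z := by
        simpa using Asymptotics.isLittleO_pow_id (𝕜 := ℂ) (n := 2) (by norm_num)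
      have ht : Filter.Tendsto (fun z => z - a) (nhds a) (nhds 0) := by
        simpa using (continuous_sub_right a).tendsto a
      exact this.comp_tendsto ht
    exact h3.differentiableAt.differentiableWithinAt
  · exact le_of_tendsto (hg z hz).norm (Filter.Eventually.of_forall fun i => (hf i).2 z hz)

/-- If all data dominated by `m` on `Λ` are interpolated by functions of some growth, then the
growth can be chosen independently of the data. -/
theorem exists_uniform_interpolation (hψ : IsDiskGauge ψ K D) {Λ : Set ℂ} (hΛ : Λ ⊆ 𝔻)
    {m : ℂ → ℝ} (hm : ∀ l ∈ Λ, 0 ≤ m l)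
    (h : ∀ w : ℂ → ℂ, (∀ l ∈ Λ, ‖w l‖ ≤ m l) →
      ∃ N f, HasDiskGrowth ψ N f ∧ ∀ l ∈ Λ, f l = w l) :
    ∃ N : ℝ, 0 ≤ N ∧ ∀ w : ℂ → ℂ, (∀ l ∈ Λ, ‖w l‖ ≤ m l) →
      ∃ f, HasDiskGrowth ψ N f ∧ ∀ l ∈ Λ, f l = w l := by
  classical
  -- Baire category in ℓ^∞(Λ): the sets of u for which u·m has an interpolant of growth N are closed
  -- by compactness and cover the space, so one of them contains a ball.
  let C : ℕ → Set (lp (fun _ : Λ => ℂ) ⊤) := fun N =>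
    {u | ∃ f, HasDiskGrowth ψ N f ∧ ∀ l : Λ, f l = u l * m l}
  have hclosed : ∀ N, IsClosed (C N) := by
    intro N
    rw [isClosed_iff_ultrafilter]
    intro u F hF hCF
    have : ∀ v, ∃ f, HasDiskGrowth ψ N f ∧ (v ∈ C N → ∀ l : Λ, f l = v l * m l) := by
      intro v
      by_cases hv : v ∈ C N
      · obtain ⟨f, hf, hfv⟩ := hv
        exact ⟨f, hf, fun _ => hfv⟩
      · exact ⟨0, HasDiskGrowth.zero ψ N, fun h => absurd h hv⟩
    choose f hf hfv using this
    obtain ⟨g, hg, hlim⟩ := hψ.exists_tendsto_of_hasDiskGrowth (Nat.cast_nonneg N) F hf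
    refine ⟨g, hg, fun l => ?_⟩
    have h1 : Filter.Tendsto (fun v : lp (fun _ : Λ => ℂ) ⊤ => v l * (m l : ℂ)) F
        (nhds (u l * m l)) := by
      have hcont : Continuous fun v : lp (fun _ : Λ => ℂ) ⊤ => v l :=
        (continuous_apply l).comp (lp.uniformContinuous_coe.continuous)
      exact (((hcont.tendsto u).mono_left hF).mul_const _)
    refine tendsto_nhds_unique (hlim l (hΛ l.2)) (h1.congr' ?_)
    filter_upwards [hCF] with v hv using (hfv v hv l).symm
  have hunion : ⋃ N, C N = Set.univ := by
    refine Set.eq_univ_of_forall fun u => ?_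
    have hu : ∀ l ∈ Λ, ‖(if hl : l ∈ Λ then u ⟨l, hl⟩ * m l / (‖u‖ + 1 : ℝ) else 0 : ℂ)‖ ≤ m l := by
      intro l hl
      rw [dif_pos hl, norm_div, norm_mul, Complex.norm_real, Complex.norm_real, Real.norm_eq_abs,
        Real.norm_eq_abs, abs_of_nonneg (hm l hl), abs_of_pos (by positivity),
        div_le_iff₀ (by positivity), mul_comm (m l)]
      have := lp.norm_apply_le_norm (by simp) u ⟨l, hl⟩
      exact mul_le_mul_of_nonneg_right (by linarith) (hm l hl)
    obtain ⟨N, f, hf, hfl⟩ := h _ hu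
    have hf2 := hf.const_mul hψ ((‖u‖ + 1 : ℝ) : ℂ)
    obtain ⟨N', hN'⟩ := exists_nat_ge (‖((‖u‖ + 1 : ℝ) : ℂ)‖ + N)
    refine Set.mem_iUnion.2 ⟨N', _, hf2.mono hψ hN', fun l => ?_⟩
    rw [hfl l l.2, dif_pos l.2]
    have : ((‖u‖ + 1 : ℝ) : ℂ) ≠ 0 := by
      rw [Complex.ofReal_ne_zero]
      positivity
    field_simp
  obtain ⟨N, u, hu⟩ := nonempty_interior_of_iUnion_of_closed hclosed hunion
  obtain ⟨ε, hε, hball⟩ := Metric.mem_nhds_iff.1 (mem_interior_iff_mem_nhds.1 hu)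
  obtain ⟨f₀, hf₀, hf₀u⟩ := interior_subset hu
  refine ⟨‖((2 / ε : ℝ) : ℂ)‖ + (max (N : ℝ) N + 1), by positivity, fun w hw => ?_⟩
  have hv : ∀ l : Λ, ‖w l / m l‖ ≤ 1 := fun l => by
    rw [norm_div, Complex.norm_real, Real.norm_eq_abs, abs_of_nonneg (hm l l.2)]
    exact div_le_one_of_le₀ (hw l l.2) (hm l l.2)
  let v : lp (fun _ : Λ => ℂ) ⊤ := ⟨fun l => w l / m l, memℓp_infty ⟨1, by
    rintro _ ⟨l, rfl⟩
    exact hv l⟩⟩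
  have hvn : ‖v‖ ≤ 1 := lp.norm_le_of_forall_le zero_le_one hv
  have hmem : u + ((ε / 2 : ℝ) : ℂ) • v ∈ C N := by
    refine hball ?_
    rw [Metric.mem_ball, dist_eq_norm, add_sub_cancel_left, norm_smul, Complex.norm_real,
      Real.norm_eq_abs, abs_of_pos (by positivity)]
    nlinarith [norm_nonneg v]
  obtain ⟨f₁, hf₁, hf₁u⟩ := hmem
  -- With u the centre of the ball, u + (ε/2)v and u both have interpolants of growth N; their
  -- difference scaled by 2/ε interpolates v·m = w.
  refine ⟨_, (hf₁.add hψ hf₀.neg).const_mul hψ ((2 / ε : ℝ) : ℂ), fun l hl => ?_⟩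
  have e1 := hf₀u ⟨l, hl⟩
  have e2 := hf₁u ⟨l, hl⟩
  have e3 : (u + ((ε / 2 : ℝ) : ℂ) • v) ⟨l, hl⟩ = u ⟨l, hl⟩ + ((ε / 2 : ℝ) : ℂ) * (w l / m l) := rfl
  have e4 : w l / m l * m l = w l := by
    refine div_mul_cancel_of_imp fun h0 => ?_
    have h0' : m l = 0 := by exact_mod_cast h0
    have := hw l hl
    rw [h0'] at this
    exact norm_le_zero_iff.1 this
  simp only at e1 e2
  rw [e1, e2, e3, add_mul, mul_assoc, e4]
  have : (ε : ℂ) ≠ 0 := Complex.ofReal_ne_zero.2 hε.ne'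
  push_cast
  field_simp
  ring

end IsDiskGauge

/-- All data of `ψ`-exponential growth on `Γ` are interpolated by functions of
`ψ`-exponential growth. -/
def IsGaugeInterpolating (ψ : ℂ → ℝ) (Γ : Set ℂ) : Prop :=
  ∀ w : ℂ → ℂ, (∃ B : ℝ, ∀ l ∈ Γ, ‖w l‖ ≤ Real.exp (B * ψ l)) →
    ∃ N f, HasDiskGrowth ψ N f ∧ ∀ l ∈ Γ, f l = w l

/-- The points of `Γ` are separated at the scale `exp (-C * ψ)`. -/
def IsGaugeSeparated (ψ : ℂ → ℝ) (C : ℝ) (Γ : Set ℂ) : Prop :=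
  ∀ l ∈ Γ, ∀ m ∈ Γ, l ≠ m → Real.exp (-C * ψ l) ≤ ‖l - m‖

/-! ### Stability of bounds on divided differences -/

namespace HasDividedDiffGrowth

variable {ψ : ℂ → ℝ} {K D : ℝ} {Λ : Set ℂ} {w w' : ℂ → ℂ} {k : ℕ}

theorem mono {Λ' : Set ℂ} (h : HasDividedDiffGrowth ψ Λ k w) (hΛ : Λ' ⊆ Λ) :
    HasDividedDiffGrowth ψ Λ' k w := by
  obtain ⟨B, hB, h⟩ := h
  exact ⟨B, hB, fun s hs hk => h s (hs.trans hΛ) hk⟩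

theorem sub (hψ : IsDiskGauge ψ K D) (hΛ : Λ ⊆ 𝔻) (hk : k ≠ 0)
    (h : HasDividedDiffGrowth ψ Λ k w) (h' : HasDividedDiffGrowth ψ Λ k w') :
    HasDividedDiffGrowth ψ Λ k fun z => w z - w' z := by
  obtain ⟨B, hB, h⟩ := h
  obtain ⟨B', hB', h'⟩ := h'
  refine ⟨B + B' + 1, by positivity, fun s hs hsk => ?_⟩
  rw [finsetDividedDiff_sub]
  have hne : s.Nonempty := by
    rw [← Finset.card_pos]
    omega
  obtain ⟨a, ha⟩ := hne
  have hnn : ∀ i ∈ s, 0 ≤ ψ i := fun i hi => zero_le_one.trans (hψ.one_le i (hΛ (hs hi)))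
  have hsum : 1 ≤ ∑ i ∈ s, ψ i :=
    (hψ.one_le a (hΛ (hs ha))).trans (Finset.single_le_sum hnn ha)
  have h1 := (h s hs hsk).trans (Real.exp_le_exp.2
    (show B * ∑ i ∈ s, ψ i ≤ (B + B') * ∑ i ∈ s, ψ i by gcongr; linarith))
  have h2 := (h' s hs hsk).trans (Real.exp_le_exp.2
    (show B' * ∑ i ∈ s, ψ i ≤ (B + B') * ∑ i ∈ s, ψ i by gcongr; linarith))
  have h3 := mul_le_mul_of_nonneg_left (Real.two_le_exp hsum)
    (Real.exp_pos ((B + B') * ∑ i ∈ s, ψ i)).le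
  rw [add_mul, one_mul, Real.exp_add]
  linarith [norm_sub_le (finsetDividedDiff w s) (finsetDividedDiff w' s)]

theorem of_finite (hψ : IsDiskGauge ψ K D) (hΛ : Λ ⊆ 𝔻) (hfin : Λ.Finite) :
    HasDividedDiffGrowth ψ Λ k w := by
  obtain ⟨M, hM⟩ := (hfin.toFinset.powerset.image fun s => ‖finsetDividedDiff w s‖).bddAbove
  refine ⟨|M|, abs_nonneg _, fun s hs hsk => ?_⟩
  have h1 : ‖finsetDividedDiff w s‖ ≤ M := hM (by
    simp only [Finset.coe_image, Set.mem_image, Finset.mem_coe, Finset.mem_powerset]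
    exact ⟨s, fun x hx => by simpa using hs hx, rfl⟩)
  rcases s.eq_empty_or_nonempty with rfl | ⟨a, ha⟩
  · simp [finsetDividedDiff]
  have hnn : ∀ i ∈ s, 0 ≤ ψ i := fun i hi => zero_le_one.trans (hψ.one_le i (hΛ (hs hi)))
  have hsum : 1 ≤ ∑ i ∈ s, ψ i :=
    (hψ.one_le a (hΛ (hs ha))).trans (Finset.single_le_sum hnn ha)
  have h2 := Real.add_one_le_exp (|M| * ∑ i ∈ s, ψ i)
  nlinarith [le_abs_self M, abs_nonneg M]

/-- Fix k + 1 points P of Λ and move the points of s into P one at a time. Each exchange costs b - a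
times a difference at k + 1 points, and finitely many differences remain inside P. -/
theorem of_succ (hψ : IsDiskGauge ψ K D) (hΛ : Λ ⊆ 𝔻)
    (h : HasDividedDiffGrowth ψ Λ (k + 1) w) : HasDividedDiffGrowth ψ Λ k w := by
  by_cases hfin : Λ.Finite
  · exact of_finite hψ hΛ hfin
  obtain ⟨P, hPΛ, hPk⟩ := (show Λ.Infinite from hfin).exists_subset_card_eq (k + 1)
  obtain ⟨B, hB, h⟩ := h
  have hnn : ∀ i ∈ Λ, 0 ≤ ψ i := fun i hi => zero_le_one.trans (hψ.one_le i (hΛ hi))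
  obtain ⟨B₀, hB₀, h₀⟩ := of_finite (k := k) (w := w) hψ (hPΛ.trans hΛ) P.finite_toSet
  set Q := ∑ i ∈ P, ψ i with hQ
  have hQ1 : 1 ≤ Q := by
    obtain ⟨a, ha⟩ : P.Nonempty := by
      rw [← Finset.card_pos]
      omega
    exact (hψ.one_le a (hΛ (hPΛ ha))).trans
      (Finset.single_le_sum (fun i hi => hnn i (hPΛ hi)) ha)
  have key : ∀ m : ℕ, ∀ s : Finset ℂ, ↑s ⊆ Λ → s.card = k → (s \ P).card = m →
      ‖finsetDividedDiff w s‖ ≤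
        Real.exp (B₀ * Q) + 2 * m * Real.exp (B * (∑ i ∈ s \ P, ψ i + Q)) := by
    intro m
    induction m with
    | zero =>
      intro s hs hsk hm
      have hsP : s ⊆ P := by rwa [Finset.card_eq_zero, Finset.sdiff_eq_empty_iff_subset] at hm
      refine (h₀ s hsP hsk).trans ?_
      simp only [CharP.cast_eq_zero, mul_zero, zero_mul, add_zero]
      gcongr
      exact Finset.sum_le_sum_of_subset_of_nonneg hsP fun i hi _ => hnn i (hPΛ hi)
    | succ m ih =>
      intro s hs hsk hm
      obtain ⟨a, ha⟩ : (s \ P).Nonempty := by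
        rw [← Finset.card_pos]
        omega
      rw [Finset.mem_sdiff] at ha
      -- P has one point more than s, so a free point of P is always available.
      obtain ⟨b, hbP, hbs⟩ := Finset.exists_mem_notMem_of_card_lt_card (s := s) (t := P) (by omega)
      set t := s.erase a with ht
      have hat : a ∉ t := Finset.notMem_erase a s
      have hs_eq : s = insert a t := (Finset.insert_erase ha.1).symm
      have hab : a ≠ b := fun e => hbs (e ▸ ha.1)
      have hbt : b ∉ t := fun e => hbs (Finset.mem_of_mem_erase e)
      have hbΛ : b ∈ Λ := hPΛ hbP
      have htΛ : ↑t ⊆ Λ := fun x hx => hs (Finset.mem_of_mem_erase hx)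
      have hbtΛ : ↑(insert b t) ⊆ Λ := by
        rw [Finset.coe_insert, Set.insert_subset_iff]
        exact ⟨hbΛ, htΛ⟩
      have hcard : (insert b t).card = k := by
        rw [Finset.card_insert_of_notMem hbt, ← hsk, hs_eq, Finset.card_insert_of_notMem hat]
      have hsd : insert b t \ P = (s \ P).erase a := by
        ext x
        simp only [ht, Finset.mem_sdiff, Finset.mem_insert, Finset.mem_erase]
        constructor
        · rintro ⟨rfl | h1, h2⟩
          · exact absurd hbP h2
          · exact ⟨h1.1, h1.2, h2⟩
        · rintro ⟨h1, h2, h3⟩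
          exact ⟨Or.inr ⟨h1, h2⟩, h3⟩
      have haP : a ∈ s \ P := Finset.mem_sdiff.2 ha
      have hi := ih (insert b t) hbtΛ hcard (by rw [hsd, Finset.card_erase_of_mem haP]; omega)
      have hle : ∑ i ∈ insert b t \ P, ψ i ≤ ∑ i ∈ s \ P, ψ i := by
        rw [hsd]
        exact Finset.sum_le_sum_of_subset_of_nonneg (Finset.erase_subset _ _)
          fun i hi _ => hnn i (hs (Finset.mem_sdiff.1 hi).1)
      have hsub := finsetDividedDiff_insert_sub_insert w hab hat hbt
      have hnew := h (insert a (insert b t)) (by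
        rw [Finset.coe_insert, Set.insert_subset_iff]
        exact ⟨hs ha.1, hbtΛ⟩) (by
        rw [Finset.card_insert_of_notMem (by simp [hab, hat]), hcard])
      have hsum : ∑ i ∈ insert a (insert b t), ψ i ≤ ∑ i ∈ s \ P, ψ i + Q := by
        have hsubset : insert a (insert b t) ⊆ (s \ P) ∪ P := by
          intro x hx
          simp only [Finset.mem_insert, ht, Finset.mem_erase] at hx
          simp only [Finset.mem_union, Finset.mem_sdiff]
          by_cases hxP : x ∈ P
          · exact Or.inr hxP
          · rcases hx with rfl | rfl | hx
            · exact Or.inl ha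
            · exact Or.inr hbP
            · exact Or.inl ⟨hx.2, hxP⟩
        rw [← Finset.sum_union Finset.sdiff_disjoint]
        refine Finset.sum_le_sum_of_subset_of_nonneg hsubset fun i hi _ => ?_
        rcases Finset.mem_union.1 hi with hi | hi
        · exact hnn i (hs (Finset.mem_sdiff.1 hi).1)
        · exact hnn i (hPΛ hi)
      have hba : ‖b - a‖ ≤ 2 := by
        have h1 : ‖b‖ < 1 := by simpa using hΛ hbΛ
        have h2 : ‖a‖ < 1 := by simpa using hΛ (hs ha.1)
        linarith [norm_sub_le b a]
      have heq : finsetDividedDiff w s = finsetDividedDiff w (insert b t) -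
          (b - a) * finsetDividedDiff w (insert a (insert b t)) := by
        rw [← hsub, hs_eq]
        ring
      rw [heq]
      refine (norm_sub_le _ _).trans ?_
      rw [norm_mul]
      have h5 : ‖b - a‖ * ‖finsetDividedDiff w (insert a (insert b t))‖ ≤
          2 * Real.exp (B * (∑ i ∈ s \ P, ψ i + Q)) := by
        refine mul_le_mul hba (hnew.trans ?_) (norm_nonneg _) zero_le_two
        gcongr
      have h6 : 2 * m * Real.exp (B * (∑ i ∈ insert b t \ P, ψ i + Q)) ≤
          2 * m * Real.exp (B * (∑ i ∈ s \ P, ψ i + Q)) := by gcongr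
      push_cast
      linarith
  refine ⟨B₀ * Q + 2 * k + (B + B * Q), by positivity, fun s hs hsk => ?_⟩
  rcases s.eq_empty_or_nonempty with rfl | ⟨a, ha⟩
  · simp [finsetDividedDiff]
  have hsum : 1 ≤ ∑ i ∈ s, ψ i :=
    (hψ.one_le a (hΛ (hs ha))).trans (Finset.single_le_sum (fun i hi => hnn i (hs hi)) ha)
  have hm : ((s \ P).card : ℝ) ≤ k := by
    exact_mod_cast (Finset.card_le_card Finset.sdiff_subset).trans hsk.le
  have hle : ∑ i ∈ s \ P, ψ i ≤ ∑ i ∈ s, ψ i :=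
    Finset.sum_le_sum_of_subset_of_nonneg Finset.sdiff_subset fun i hi _ => hnn i (hs hi)
  set S := ∑ i ∈ s, ψ i with hS
  have hE : 1 ≤ Real.exp (B * (S + Q)) := Real.one_le_exp (by positivity)
  have hE0 : 1 ≤ Real.exp (B₀ * Q) := Real.one_le_exp (by positivity)
  calc ‖finsetDividedDiff w s‖
      ≤ Real.exp (B₀ * Q) + 2 * (s \ P).card * Real.exp (B * (∑ i ∈ s \ P, ψ i + Q)) :=
        key _ s hs hsk rfl
    _ ≤ Real.exp (B₀ * Q) + 2 * k * Real.exp (B * (S + Q)) := by gcongr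
    _ ≤ Real.exp (B₀ * Q) * ((2 * k + 1) * Real.exp (B * (S + Q))) := by
        have h7 : 0 ≤ 2 * (k : ℝ) * Real.exp (B * (S + Q)) := by positivity
        nlinarith
    _ ≤ Real.exp (B₀ * Q) * (Real.exp (2 * k) * Real.exp (B * (S + Q))) := by
        gcongr
        exact Real.add_one_le_exp _
    _ ≤ _ := by
        rw [← Real.exp_add, ← Real.exp_add]
        gcongr
        have h8 : B₀ * Q ≤ B₀ * Q * S := le_mul_of_one_le_right (by positivity) hsum
        have h9 : 2 * (k : ℝ) ≤ 2 * k * S := le_mul_of_one_le_right (by positivity) hsum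
        have h10 : B * Q ≤ B * Q * S := le_mul_of_one_le_right (by positivity) hsum
        linarith

theorem exists_of_card_le (hψ : IsDiskGauge ψ K D) (hΛ : Λ ⊆ 𝔻)
    (h : HasDividedDiffGrowth ψ Λ k w) :
    ∃ B : ℝ, 0 ≤ B ∧ ∀ s : Finset ℂ, ↑s ⊆ Λ → s.card ≤ k →
      ‖finsetDividedDiff w s‖ ≤ Real.exp (B * ∑ i ∈ s, ψ i) := by
  induction k with
  | zero =>
    obtain ⟨B, hB, h⟩ := h
    exact ⟨B, hB, fun s hs hk => h s hs (Nat.le_zero.1 hk)⟩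
  | succ k ih =>
    obtain ⟨B, hB, h1⟩ := ih (h.of_succ hψ hΛ)
    obtain ⟨B', hB', h2⟩ := h
    refine ⟨B + B', by positivity, fun s hs hk => ?_⟩
    have hsum : 0 ≤ ∑ i ∈ s, ψ i :=
      Finset.sum_nonneg fun i hi => zero_le_one.trans (hψ.one_le i (hΛ (hs hi)))
    rcases Nat.le_succ_iff.1 hk with hk | hk
    · refine (h1 s hs hk).trans ?_
      gcongr
      linarith
    · refine (h2 s hs hk).trans ?_
      gcongr
      linarith

end HasDividedDiffGrowth

theorem IsGaugeInterpolating.mono {ψ : ℂ → ℝ} {Γ Γ' : Set ℂ} (h : IsGaugeInterpolating ψ Γ)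
    (hΓ : Γ' ⊆ Γ) : IsGaugeInterpolating ψ Γ' := by
  classical
  rintro w ⟨B, hB⟩
  obtain ⟨N, f, hf, hfw⟩ := h (fun z => if z ∈ Γ' then w z else 0) ⟨B, fun l _ => by
    split_ifs with hl
    · exact hB l hl
    · simpa using (Real.exp_pos _).le⟩
  exact ⟨N, f, hf, fun l hl => by simpa [hl] using hfw l (hΓ hl)⟩

/-! ### Interpolating sets: separation, summability, vanishing functions -/

namespace IsDiskGauge

variable {ψ : ℂ → ℝ} {K D : ℝ} {Γ : Set ℂ}

theorem exists_uniform_of_isGaugeInterpolating (hψ : IsDiskGauge ψ K D) (hΓ : Γ ⊆ 𝔻)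
    (h : IsGaugeInterpolating ψ Γ) (B : ℝ) :
    ∃ N : ℝ, 0 ≤ N ∧ ∀ w : ℂ → ℂ, (∀ l ∈ Γ, ‖w l‖ ≤ Real.exp (B * ψ l)) →
      ∃ f, HasDiskGrowth ψ N f ∧ ∀ l ∈ Γ, f l = w l :=
  hψ.exists_uniform_interpolation hΓ (fun _ _ => (Real.exp_pos _).le) fun w hw => h w ⟨B, hw⟩

/-- A function of uniform growth equal to 1 at l and 0 at a nearby m has slope 1/|l - m| in modulus,
and the Schwarz bound limits this slope. -/
theorem exists_isGaugeSeparated (hψ : IsDiskGauge ψ K D) (hΓ : Γ ⊆ 𝔻)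
    (h : IsGaugeInterpolating ψ Γ) : ∃ C : ℝ, 0 ≤ C ∧ IsGaugeSeparated ψ C Γ := by
  classical
  have hK := hψ.pos
  have hD := hψ.one_le_const
  obtain ⟨N, hN, hunif⟩ := hψ.exists_uniform_of_isGaugeInterpolating hΓ h 0
  refine ⟨N * D + K + 1, by positivity, fun l hl m hm hlm => ?_⟩
  have hψl := hψ.one_le l (hΓ hl)
  rcases lt_or_ge ‖m - l‖ (Real.exp (-K * ψ l)) with hlt | hge
  · obtain ⟨f, hf, hfw⟩ := hunif (fun z => if z = l then 1 else 0) fun z _ => by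
      split_ifs <;> simp
    have hfl : f l = 1 := by simpa using hfw l hl
    have hfm : f m = 0 := by simpa [hlm.symm] using hfw m hm
    have h1 := hψ.norm_dslope_le_of_norm_sub_lt hf.1 zero_le_one hN (by simpa using hf.2)
      (hΓ hl) hlt
    rw [dslope_of_ne _ hlm.symm, slope_def_field, hfl, hfm, norm_div, zero_sub, norm_neg,
      norm_one, mul_one, one_div] at h1
    have hpos : 0 < ‖m - l‖ := norm_pos_iff.2 (sub_ne_zero.2 hlm.symm)
    rw [norm_sub_rev, neg_mul, Real.exp_neg, inv_le_comm₀ (Real.exp_pos _) hpos]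
    refine h1.trans ?_
    rw [add_mul _ 1, Real.exp_add, mul_comm, one_mul]
    gcongr
    exact Real.two_le_exp hψl
  · rw [norm_sub_rev]
    refine le_trans ?_ hge
    rw [Real.exp_le_exp]
    have : 0 ≤ (N * D + 1) * ψ l := by positivity
    nlinarith

/-- Area count: the disks of radius exp(-Cψ(l))/2 about the points are disjoint and lie in the disk
of radius 2, whence the bound 16. -/
theorem summable_of_isGaugeSeparated (hψ : IsDiskGauge ψ K D) (hΓ : Γ ⊆ 𝔻) {C : ℝ} (hC : 0 ≤ C)
    (h : IsGaugeSeparated ψ C Γ) : Summable fun l : Γ => Real.exp (-(2 * C) * ψ l) := by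
  have hvol : ∀ (a : ℂ) (r : ℝ), 0 ≤ r →
      (MeasureTheory.volume : MeasureTheory.Measure ℂ).real (Metric.ball a r) = r ^ 2 * Real.pi := by
    intro a r hr
    rw [MeasureTheory.measureReal_def, Complex.volume_ball]
    simp [hr]
  refine summable_of_sum_le (c := 16) (fun _ => (Real.exp_pos _).le) fun s => ?_
  set ρ : Γ → ℝ := fun l => Real.exp (-C * ψ l) / 2 with hρ
  have hdisj : (s : Set Γ).PairwiseDisjoint fun l => Metric.ball (l : ℂ) (ρ l) := by
    intro l _ m _ hlm
    refine Metric.ball_disjoint_ball ?_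
    rw [dist_eq_norm]
    have hlm' : (l : ℂ) ≠ m := fun e => hlm (Subtype.ext e)
    have h1 := h l l.2 m m.2 hlm'
    have h2 := h m m.2 l l.2 hlm'.symm
    rw [norm_sub_rev] at h2
    simp only [hρ]
    linarith
  have h1 := MeasureTheory.measureReal_biUnion_finset
    (μ := (MeasureTheory.volume : MeasureTheory.Measure ℂ)) hdisj
    (fun _ _ => measurableSet_ball) (fun _ _ => by
      rw [Complex.volume_ball]
      exact ENNReal.mul_ne_top (by simp) (by simp))
  have h2 : (MeasureTheory.volume : MeasureTheory.Measure ℂ).real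
      (⋃ l ∈ s, Metric.ball (l : ℂ) (ρ l)) ≤
      (MeasureTheory.volume : MeasureTheory.Measure ℂ).real (Metric.ball 0 2) := by
    refine MeasureTheory.measureReal_mono ?_ (by
      rw [Complex.volume_ball]
      exact ENNReal.mul_ne_top (by simp) (by simp))
    refine Set.iUnion₂_subset fun l _ => Metric.ball_subset_ball' ?_
    have hl : dist (l : ℂ) 0 < 1 := hΓ l.2
    have : Real.exp (-C * ψ l) ≤ 1 := by
      have := hψ.one_le l (hΓ l.2)
      rw [Real.exp_le_one_iff]
      nlinarith
    simp only [hρ]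
    linarith
  rw [h1, hvol _ _ zero_le_two] at h2
  have h3 : ∀ l ∈ s, (MeasureTheory.volume : MeasureTheory.Measure ℂ).real
      (Metric.ball (l : ℂ) (ρ l)) = Real.exp (-(2 * C) * ψ l) * (Real.pi / 4) := by
    intro l _
    rw [hvol _ _ (by positivity), hρ, show -(2 * C) * ψ l = -C * ψ l + -C * ψ l by ring,
      Real.exp_add]
    ring
  rw [Finset.sum_congr rfl h3, ← Finset.sum_mul] at h2
  nlinarith [Real.pi_pos]

theorem exists_hasDiskGrowth_tsum (hψ : IsDiskGauge ψ K D) {M N : ℝ} (hN : 0 ≤ N)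
    (hsum : Summable fun l : Γ => Real.exp (-M * ψ l)) {G : Γ → ℂ → ℂ}
    (hG : ∀ l, DifferentiableOn ℂ (G l) 𝔻)
    (hb : ∀ l, ∀ z ∈ 𝔻, ‖G l z‖ ≤ Real.exp (N * ψ z) * Real.exp (-M * ψ l)) :
    ∃ N', HasDiskGrowth ψ N' fun z => ∑' l, G l z := by
  set S := ∑' l : Γ, Real.exp (-M * ψ l) with hS
  have hS0 : 0 ≤ S := tsum_nonneg fun _ => (Real.exp_pos _).le
  refine ⟨S + N, fun a ha => ?_, fun z hz => ?_⟩
  · have hsub : Metric.ball a (Real.exp (-K * ψ a)) ⊆ 𝔻 := fun w hw =>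
      hψ.mem_of_norm_sub_lt ha (by simpa [dist_eq_norm] using hw)
    have := Complex.differentiableOn_tsum_of_summable_norm
      (hsum.mul_left (Real.exp (N * (D * ψ a)))) (fun l => (hG l).mono hsub)
      Metric.isOpen_ball fun l w hw => by
        refine (hb l w (hsub hw)).trans ?_
        gcongr
        exact hψ.le_mul a ha w (hsub hw) (by simpa [dist_eq_norm] using hw)
    exact (this.differentiableAt (Metric.ball_mem_nhds a (Real.exp_pos _))).differentiableWithinAt
  · have h1 := tsum_of_norm_bounded (hsum.mul_left (Real.exp (N * ψ z))).hasSum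
      fun l => hb l z hz
    rw [tsum_mul_left] at h1
    refine h1.trans ?_
    rw [add_mul, Real.exp_add, mul_comm]
    gcongr
    have := Real.add_one_le_exp (S * ψ z)
    nlinarith [hψ.one_le z hz]

/-- If `Γ` is interpolating and `γ` is outside `Γ`, there is a function of controlled growth which
vanishes on `Γ` and whose value at `γ` is `1` or the difference of `γ` and a nearby point of `Γ`. -/
theorem exists_vanishing (hψ : IsDiskGauge ψ K D) (hΓ : Γ ⊆ 𝔻) (h : IsGaugeInterpolating ψ Γ) :
    ∃ N : ℝ, 0 ≤ N ∧ ∀ γ ∈ 𝔻, γ ∉ Γ → ∃ T : Finset ℂ, ↑T ⊆ Γ ∧ T.card ≤ 1 ∧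
      (∀ μ ∈ T, ‖γ - μ‖ < Real.exp (-K * ψ μ)) ∧
      ∃ H, HasDiskGrowth ψ N H ∧ (∀ l ∈ Γ, H l = 0) ∧ H γ = ∏ μ ∈ T, (γ - μ) := by
  classical
  have hK := hψ.pos
  obtain ⟨C, hC, hsep⟩ := hψ.exists_isGaugeSeparated hΓ h
  -- At radius exp(-(C + 1 + K)ψ), the part C + 1 + K ≥ C + 1 halves the separation, so at most one
  -- point of Γ is that close to γ; the K keeps this point within its gauge disk.
  obtain ⟨N, hN, hunif⟩ := hψ.exists_uniform_of_isGaugeInterpolating hΓ h (C + 1 + K)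
  refine ⟨N + 3, by positivity, fun γ hγ hγΓ => ?_⟩
  have hγ1 : ‖γ‖ < 1 := by simpa using hγ
  obtain ⟨h₀, hh₀, hw⟩ := hunif
    (fun l => if ‖γ - l‖ < Real.exp (-(C + 1 + K) * ψ l) then 0 else (γ - l)⁻¹) fun l hl => by
      split_ifs with hlt
      · simpa using (Real.exp_pos _).le
      · rw [norm_inv]
        refine inv_le_of_inv_le₀ (Real.exp_pos _) ?_
        rw [← Real.exp_neg, ← neg_mul]
        exact not_lt.1 hlt
  -- As h₀ interpolates 1/(γ - l) at the far points, g vanishes there while g(γ) = 1. A close point,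
  -- if any, is handled by a factor z - μ.
  set g : ℂ → ℂ := fun z => 1 - (γ - z) * h₀ z with hg
  have hgd : DifferentiableOn ℂ g 𝔻 :=
    (differentiableOn_const 1).sub (((differentiableOn_const γ).sub differentiableOn_id).mul hh₀.1)
  have hgb : ∀ z ∈ 𝔻, ‖g z‖ ≤ Real.exp ((N + 2) * ψ z) := by
    intro z hz
    have hz1 : ‖z‖ < 1 := by simpa using hz
    have hψz := hψ.one_le z hz
    have h1 := hh₀.2 z hz
    have h2 : 1 ≤ Real.exp (N * ψ z) := Real.one_le_exp (by positivity)
    have h3 : ‖g z‖ ≤ 1 + 2 * Real.exp (N * ψ z) := by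
      refine (norm_sub_le _ _).trans ?_
      rw [norm_one, norm_mul]
      gcongr
      linarith [norm_sub_le γ z]
    have h4 : 3 ≤ Real.exp (2 * ψ z) := by linarith [Real.add_one_le_exp (2 * ψ z)]
    rw [add_mul, Real.exp_add]
    nlinarith
  have hgl : ∀ l ∈ Γ, ¬ ‖γ - l‖ < Real.exp (-(C + 1 + K) * ψ l) → g l = 0 := by
    intro l hl hlt
    have hne : γ - l ≠ 0 := sub_ne_zero.2 fun e => hγΓ (e ▸ hl)
    simp only [hg]
    rw [hw l hl, if_neg hlt, mul_inv_cancel₀ hne, sub_self]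
  have hgγ : g γ = 1 := by simp [hg]
  by_cases hclose : ∃ μ ∈ Γ, ‖γ - μ‖ < Real.exp (-(C + 1 + K) * ψ μ)
  · obtain ⟨μ, hμ, hμγ⟩ := hclose
    have hμ1 : ‖μ‖ < 1 := by simpa using hΓ hμ
    have hψμ := hψ.one_le μ (hΓ hμ)
    refine ⟨{μ}, by simpa using hμ, by simp, ?_, fun z => (z - μ) * g z,
      ⟨(differentiableOn_id.sub (differentiableOn_const μ)).mul hgd, ?_⟩, ?_, by simp [hgγ]⟩
    · intro ν hν
      rw [Finset.mem_singleton] at hν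
      subst hν
      refine hμγ.trans_le ?_
      rw [Real.exp_le_exp]
      nlinarith
    · intro z hz
      have hz1 : ‖z‖ < 1 := by simpa using hz
      rw [norm_mul, show (N + 3) * ψ z = ψ z + (N + 2) * ψ z by ring, Real.exp_add]
      refine mul_le_mul ?_ (hgb z hz) (norm_nonneg _) (Real.exp_pos _).le
      linarith [norm_sub_le z μ, Real.two_le_exp (hψ.one_le z hz)]
    · intro l hl
      by_cases hlμ : l = μ
      · simp [hlμ]
      · have hψl := hψ.one_le l (hΓ hl)
        have hhalf : ∀ ν, 1 ≤ ψ ν → Real.exp (-(C + 1 + K) * ψ ν) ≤ Real.exp (-C * ψ ν) / 2 := by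
          intro ν hν
          rw [show -(C + 1 + K) * ψ ν = -C * ψ ν + -((1 + K) * ψ ν) by ring, Real.exp_add,
            Real.exp_neg, div_eq_mul_inv]
          gcongr
          exact Real.two_le_exp (by nlinarith)
        have hnot : ¬ ‖γ - l‖ < Real.exp (-(C + 1 + K) * ψ l) := by
          intro hlt
          have h1 := hsep l hl μ hμ hlμ
          have h2 := hsep μ hμ l hl (Ne.symm hlμ)
          have h3 : ‖l - μ‖ ≤ ‖γ - l‖ + ‖γ - μ‖ := by
            rw [norm_sub_rev γ l]
            simpa using norm_add_le (l - γ) (γ - μ)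
          rw [norm_sub_rev] at h2
          linarith [hhalf l hψl, hhalf μ hψμ]
        simp [hgl l hl hnot]
  · refine ⟨∅, by simp, by simp, by simp, g, ⟨hgd, fun z hz => (hgb z hz).trans ?_⟩,
      fun l hl => hgl l hl fun hlt => hclose ⟨l, hl, hlt⟩, by simp [hgγ]⟩
    have := hψ.one_le z hz
    gcongr
    norm_num

theorem exists_vanishing_iUnion (hψ : IsDiskGauge ψ K D) {S : ℕ → Set ℂ} (hS : ∀ i, S i ⊆ 𝔻)
    (h : ∀ i, IsGaugeInterpolating ψ (S i)) (hdisj : Pairwise (Function.onFun Disjoint S)) (n : ℕ) :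
    ∃ N : ℝ, 0 ≤ N ∧ ∀ γ ∈ 𝔻, (∀ i < n, γ ∉ S i) → ∃ T : Finset ℂ, (∀ μ ∈ T, ∃ i < n, μ ∈ S i) ∧
      T.card ≤ n ∧ (∀ μ ∈ T, ‖γ - μ‖ < Real.exp (-K * ψ μ)) ∧
      ∃ H, HasDiskGrowth ψ N H ∧ (∀ i < n, ∀ l ∈ S i, H l = 0) ∧ H γ = ∏ μ ∈ T, (γ - μ) := by
  classical
  induction n with
  | zero =>
    refine ⟨0, le_rfl, fun γ _ _ => ⟨∅, by simp, by simp, by simp, fun _ => 1,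
      ⟨differentiableOn_const 1, by simp⟩, by simp, by simp⟩⟩
  | succ n ih =>
    obtain ⟨N, hN, ih⟩ := ih
    obtain ⟨N', hN', hnew⟩ := hψ.exists_vanishing (hS n) (h n)
    refine ⟨N + N', by positivity, fun γ hγ hγS => ?_⟩
    obtain ⟨T, hT, hTn, hTγ, H, hH, hH0, hHγ⟩ := ih γ hγ fun i hi => hγS i (by omega)
    obtain ⟨T', hT', hTn', hTγ', H', hH', hH0', hHγ'⟩ := hnew γ hγ (hγS n (by omega))
    have hTT : Disjoint T T' := by
      rw [Finset.disjoint_left]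
      intro μ h1 h2
      obtain ⟨i, hi, hμ⟩ := hT μ h1
      exact Set.disjoint_left.1 (hdisj hi.ne) hμ (hT' h2)
    refine ⟨T ∪ T', fun μ hμ => ?_, (Finset.card_union_le _ _).trans (by omega), fun μ hμ => ?_, _,
      hH.mul hH', fun i hi l hl => ?_, ?_⟩
    · rcases Finset.mem_union.1 hμ with hμ | hμ
      · obtain ⟨i, hi, hμ⟩ := hT μ hμ
        exact ⟨i, by omega, hμ⟩
      · exact ⟨n, by omega, hT' hμ⟩
    · rcases Finset.mem_union.1 hμ with hμ | hμ
      · exact hTγ μ hμ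
      · exact hTγ' μ hμ
    · rcases Nat.lt_succ_iff_lt_or_eq.1 hi with hi | rfl
      · simp [hH0 i hi l hl]
      · simp [hH0' l hl]
    · rw [Finset.prod_union hTT, hHγ, hHγ']

end IsDiskGauge

/-- Greedy colouring of a countable graph all of whose vertices have fewer than `n` neighbours. -/
theorem exists_greedy_coloring {α : Type*} [Countable α] {n : ℕ} (hn : 0 < n) (r : α → α → Prop)
    (hr : ∀ a b, r a b → r b a) (hirr : ∀ a, ¬ r a a) (T : α → Finset α)
    (hT : ∀ a, (T a).card < n) (hrT : ∀ a b, r a b → b ∈ T a) :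
    ∃ c : α → Fin n, ∀ a b, r a b → c a ≠ c b := by
  classical
  obtain ⟨e, he⟩ := exists_injective_nat α
  have hex : ∀ (a : α) (ih : ∀ b, e b < e a → Fin n),
      ∃ k : Fin n, ∀ b ∈ T a, ∀ h : e b < e a, ih b h ≠ k := by
    intro a ih
    obtain ⟨k, -, hk⟩ := Finset.exists_mem_notMem_of_card_lt_card (t := Finset.univ)
      (s := (T a).image fun b => if h : e b < e a then ih b h else ⟨0, hn⟩)
      (by simpa using Finset.card_image_le.trans_lt (hT a))
    refine ⟨k, fun b hb h hbk => hk (Finset.mem_image.2 ⟨b, hb, ?_⟩)⟩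
    rw [dif_pos h, hbk]
  choose F hF using hex
  have wf : WellFounded fun a b => e a < e b := (measure e).wf
  let c : α → Fin n := wf.fix F
  have hc : ∀ a, c a = F a fun b _ => c b := fun a => wf.fix_eq F a
  have key : ∀ a b, r a b → e b < e a → c a ≠ c b := by
    intro a b hab hlt
    rw [hc a]
    exact (hF a (fun b _ => c b) b (hrT a b hab) hlt).symm
  refine ⟨c, fun a b hab => ?_⟩
  rcases lt_trichotomy (e a) (e b) with h | h | h
  · exact (key b a (hr a b hab) h).symm
  · exact absurd (he h ▸ hab) (hirr a)
  · exact key a b hab h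

/-! ### Interpolation on a union; division by zeros -/

namespace IsDiskGauge

variable {ψ : ℂ → ℝ} {K D : ℝ}

theorem exists_interpolation_iUnion (hψ : IsDiskGauge ψ K D) {S : ℕ → Set ℂ} (hS : ∀ i, S i ⊆ 𝔻)
    (h : ∀ i, IsGaugeInterpolating ψ (S i)) (hdisj : Pairwise (Function.onFun Disjoint S)) (n : ℕ)
    (w : ℂ → ℂ) (hw : HasDividedDiffGrowth ψ {z | ∃ i < n, z ∈ S i} n w) :
    ∃ N f, HasDiskGrowth ψ N f ∧ ∀ i < n, ∀ l ∈ S i, f l = w l := by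
  classical
  have hD := hψ.one_le_const
  induction n generalizing w with
  | zero => exact ⟨0, 0, HasDiskGrowth.zero ψ 0, by simp⟩
  | succ n ih =>
    have hU : {z | ∃ i < n + 1, z ∈ S i} ⊆ 𝔻 := fun z ⟨i, _, hz⟩ => hS i hz
    obtain ⟨N₀, f₀, hf₀, hf₀w⟩ := ih w ((hw.of_succ hψ hU).mono
      fun z ⟨i, hi, hz⟩ => ⟨i, by omega, hz⟩)
    have hf₀' := hf₀.mono hψ (le_max_left N₀ 0)
    -- All cardinalities up to n + 1 are needed, since the set T of nearby points may have fewer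
    -- than n elements.
    obtain ⟨B, hB, hBw⟩ := (hw.sub hψ hU (by omega) (hψ.hasDividedDiffGrowth (le_max_right N₀ 0)
      hf₀' hU (n + 1))).exists_of_card_le hψ hU
    set w' : ℂ → ℂ := fun z => w z - f₀ z with hw'
    have hw'0 : ∀ i < n, ∀ l ∈ S i, w' l = 0 := fun i hi l hl => by simp [hw', hf₀w i hi l hl]
    obtain ⟨N₁, hN₁, hvan⟩ := hψ.exists_vanishing_iUnion hS h hdisj n
    obtain ⟨C, hC, hsep⟩ := hψ.exists_isGaugeSeparated (hS n) (h n)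
    -- The part B(1 + nD) compensates the divided difference at γ and T, where ψ ≤ Dψ(γ) on T; the
    -- part 2C leaves a summable factor.
    obtain ⟨N₂, hN₂, hunif⟩ := hψ.exists_uniform_of_isGaugeInterpolating (hS n) (h n)
      (B * (1 + n * D) + 2 * C)
    have hG : ∀ γ : S n, ∃ G : ℂ → ℂ, DifferentiableOn ℂ G 𝔻 ∧
        (∀ z ∈ 𝔻, ‖G z‖ ≤ Real.exp ((N₁ + N₂) * ψ z) * Real.exp (-(2 * C) * ψ γ)) ∧
        G γ = w' γ ∧ (∀ l ∈ S n, l ≠ γ → G l = 0) ∧ ∀ i < n, ∀ l ∈ S i, G l = 0 := by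
      rintro ⟨γ, hγ⟩
      have hγD := hS n hγ
      have hγS : ∀ i < n, γ ∉ S i := fun i hi hγi => Set.disjoint_left.1 (hdisj hi.ne) hγi hγ
      obtain ⟨T, hTS, hTn, hTγ, H, hH, hH0, hHγ⟩ := hvan γ hγD hγS
      obtain ⟨F, hF, hFw⟩ := hunif (fun z => if z = γ then
          ((Real.exp ((B * (1 + n * D) + 2 * C) * ψ γ) : ℝ) : ℂ) else 0) fun l _ => by
        split_ifs with hl
        · rw [Complex.norm_real, Real.norm_eq_abs, Real.abs_exp, hl]
        · simpa using (Real.exp_pos _).le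
      have hγT : γ ∉ T := fun hγT => by
        obtain ⟨i, hi, hγi⟩ := hTS γ hγT
        exact hγS i hi hγi
      have hprod : ∏ μ ∈ T, (γ - μ) ≠ 0 :=
        Finset.prod_ne_zero_iff.2 fun μ hμ => sub_ne_zero.2 fun e => hγT (e ▸ hμ)
      have hTU : ↑(insert γ T) ⊆ {z | ∃ i < n + 1, z ∈ S i} := by
        intro z hz
        rcases Finset.mem_insert.1 (Finset.mem_coe.1 hz) with rfl | hz
        · exact ⟨n, by omega, hγ⟩
        · obtain ⟨i, hi, hzi⟩ := hTS z hz
          exact ⟨i, by omega, hzi⟩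
      have hdd := hBw (insert γ T) hTU (by
        rw [Finset.card_insert_of_notMem hγT]
        omega)
      -- Since w' vanishes on T, its divided difference at γ and T is w'(γ) divided by the value
      -- H(γ).
      rw [finsetDividedDiff_insert_of_eq_zero hγT (fun i hi => by
        obtain ⟨j, hj, hij⟩ := hTS i hi
        exact hw'0 j hj i hij), Finset.sum_insert hγT] at hdd
      have hψγ := hψ.one_le γ hγD
      have hsumT : ∑ μ ∈ T, ψ μ ≤ n * (D * ψ γ) := by
        have h1 : ∀ μ ∈ T, ψ μ ≤ D * ψ γ := fun μ hμ =>
          hψ.le_mul' μ (hU (hTU (by simp [hμ]))) γ hγD (hTγ μ hμ)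
        refine (Finset.sum_le_card_nsmul T _ _ h1).trans ?_
        rw [nsmul_eq_mul]
        gcongr
      have hcb : ‖w' γ * ∏ k ∈ T, (γ - k)⁻¹‖ ≤ Real.exp (B * (1 + n * D) * ψ γ) := by
        refine hdd.trans ?_
        rw [Real.exp_le_exp, mul_assoc]
        gcongr
        linarith
      refine ⟨fun z => (w' γ * ∏ k ∈ T, (γ - k)⁻¹) *
        ((Real.exp (-((B * (1 + n * D) + 2 * C) * ψ γ)) : ℝ) : ℂ) * (H z * F z),
        (hH.1.mul hF.1).const_mul _, fun z hz => ?_, ?_, ?_, ?_⟩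
      · rw [norm_mul, norm_mul, Complex.norm_real, Real.norm_eq_abs, Real.abs_exp]
        have h1 := (hH.mul hF).2 z hz
        calc _ ≤ Real.exp (B * (1 + n * D) * ψ γ) *
              Real.exp (-((B * (1 + n * D) + 2 * C) * ψ γ)) * Real.exp ((N₁ + N₂) * ψ z) := by
              gcongr
          _ = _ := by
              rw [← Real.exp_add, ← Real.exp_add, ← Real.exp_add]
              ring_nf
      · have hFγ := hFw γ hγ
        rw [if_pos rfl] at hFγ
        simp only [hHγ, hFγ]
        rw [Finset.prod_inv_distrib, Real.exp_neg, Complex.ofReal_inv]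
        have : ((Real.exp ((B * (1 + n * D) + 2 * C) * ψ γ) : ℝ) : ℂ) ≠ 0 :=
          Complex.ofReal_ne_zero.2 (Real.exp_ne_zero _)
        field_simp
      · intro l hl hlγ
        have := hFw l hl
        rw [if_neg hlγ] at this
        simp [this]
      · intro i hi l hl
        simp [hH0 i hi l hl]
    choose G hGd hGb hGγ hG0 hG0' using hG
    obtain ⟨N₃, hN₃⟩ := hψ.exists_hasDiskGrowth_tsum (add_nonneg hN₁ hN₂)
      (hψ.summable_of_isGaugeSeparated (hS n) hC hsep) hGd hGb
    refine ⟨_, _, hf₀.add hψ hN₃, fun i hi l hl => ?_⟩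
    rcases Nat.lt_succ_iff_lt_or_eq.1 hi with hi | rfl
    · simp [hG0' _ i hi l hl, hf₀w i hi l hl]
    · rw [tsum_eq_single ⟨l, hl⟩ fun γ hγ => hG0 γ l hl fun e => hγ (Subtype.ext e.symm)]
      have := hGγ ⟨l, hl⟩
      simp only at this
      rw [this, hw']
      ring

theorem exists_eq_mul_prod_sub (hψ : IsDiskGauge ψ K D) {t : Finset ℂ} (ht : ↑t ⊆ 𝔻) {P N : ℝ}
    (hP : 0 ≤ P) (hN : 0 ≤ N) {f : ℂ → ℂ} (hf : DifferentiableOn ℂ f 𝔻)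
    (hb : ∀ z ∈ 𝔻, ‖f z‖ ≤ P * Real.exp (N * ψ z)) (h0 : ∀ μ ∈ t, f μ = 0) :
    ∃ g : ℂ → ℂ, DifferentiableOn ℂ g 𝔻 ∧ (∀ z, f z = g z * ∏ μ ∈ t, (z - μ)) ∧
      ∀ z ∈ 𝔻, ‖g z‖ ≤ P * Real.exp ((K + 1) * ∑ μ ∈ t, ψ μ) *
        Real.exp (N * D ^ (2 * t.card) * ψ z) := by
  classical
  have hD := hψ.one_le_const
  induction t using Finset.induction_on generalizing f P N with
  | empty => exact ⟨f, hf, by simp, by simpa using hb⟩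
  | insert a t hat ih =>
    rw [Finset.coe_insert, Set.insert_subset_iff] at ht
    have hψa := hψ.one_le a ht.1
    have hfa : f a = 0 := h0 a (by simp)
    have hfd : ∀ z, f z = (z - a) * dslope f a z := fun z => by
      have := sub_smul_dslope f a z
      rw [smul_eq_mul, hfa, sub_zero] at this
      exact this.symm
    obtain ⟨g, hg, hfg, hgb⟩ := ih ht.2 (P := 2 * P * Real.exp (K * ψ a)) (N := N * D ^ 2)
      (by positivity) (by positivity) (differentiableOn_dslope hf ht.1)
      (fun z hz => hψ.norm_dslope_le_of_eq_zero hf hP hN hb ht.1 hz hfa) (fun μ hμ => by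
        have h1 := hfd μ
        rw [h0 μ (by simp [hμ])] at h1
        exact (mul_eq_zero.1 h1.symm).resolve_left (sub_ne_zero.2 fun e => hat (e ▸ hμ)))
    refine ⟨g, hg, fun z => ?_, fun z hz => (hgb z hz).trans ?_⟩
    · rw [hfd z, hfg z, Finset.prod_insert hat]
      ring
    · rw [Finset.sum_insert hat, Finset.card_insert_of_notMem hat]
      have e : N * D ^ 2 * D ^ (2 * t.card) = N * D ^ (2 * (t.card + 1)) := by ring
      rw [e]
      refine mul_le_mul_of_nonneg_right ?_ (Real.exp_pos _).le
      rw [mul_add, Real.exp_add, add_mul K 1 (ψ a), one_mul, Real.exp_add]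
      have := Real.two_le_exp hψa
      calc 2 * P * Real.exp (K * ψ a) * Real.exp ((K + 1) * ∑ i ∈ t, ψ i)
          ≤ Real.exp (ψ a) * P * Real.exp (K * ψ a) * Real.exp ((K + 1) * ∑ i ∈ t, ψ i) := by
            gcongr
        _ = _ := by ring

end IsDiskGauge

/-! ### Decomposition into interpolating sets -/

namespace IsDiskGauge

variable {ψ : ℂ → ℝ} {K D : ℝ} {Λ : Set ℂ} {n : ℕ}

/-- Data dominated at each point `l` by the product of the distances from `l` to its `n - 1` nearest
neighbours have controlled divided differences of order `n - 1`; here the nearest neighbours are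
collected in `T l`. -/
theorem exists_nearest_hasDividedDiffGrowth (hψ : IsDiskGauge ψ K D) (hΛ : Λ ⊆ 𝔻)
    (hfin : ∀ a ∈ 𝔻, (Λ ∩ Metric.closedBall a (Real.exp (-(K + 1) * ψ a))).Finite)
    (hn : 0 < n) :
    ∃ T : ℂ → Finset ℂ, (∀ l ∈ Λ, ↑(T l) ⊆ Λ ∧ l ∉ T l ∧ (T l).card < n ∧
        ∀ μ ∈ T l, ‖μ - l‖ < Real.exp (-K * ψ l)) ∧
      ∀ M : ℝ, 0 ≤ M → ∀ w : ℂ → ℂ,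
        (∀ l ∈ Λ, ‖w l‖ ≤ Real.exp (M * ψ l) * ∏ μ ∈ T l, ‖l - μ‖) →
          HasDividedDiffGrowth ψ Λ n w := by
  classical
  have hK := hψ.pos
  -- T(l) minimises the product of distances among sets of fewer than n close points; only this
  -- minimality is used. The radius with K + 1 gives strict inclusion in the gauge disk.
  have hmin : ∀ l, ∃ T : Finset ℂ, l ∈ Λ → T.card < n ∧
      (∀ μ ∈ T, μ ∈ Λ ∧ μ ≠ l ∧ ‖μ - l‖ ≤ Real.exp (-(K + 1) * ψ l)) ∧
      ∀ T' : Finset ℂ, T'.card < n →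
        (∀ μ ∈ T', μ ∈ Λ ∧ μ ≠ l ∧ ‖μ - l‖ ≤ Real.exp (-(K + 1) * ψ l)) →
          ∏ μ ∈ T, ‖l - μ‖ ≤ ∏ μ ∈ T', ‖l - μ‖ := by
    intro l
    by_cases hl : l ∈ Λ
    · set V := (hfin l (hΛ hl)).toFinset.erase l with hV
      have hmem : ∀ μ, μ ∈ V ↔ μ ∈ Λ ∧ μ ≠ l ∧ ‖μ - l‖ ≤ Real.exp (-(K + 1) * ψ l) := by
        intro μ
        simp only [hV, Finset.mem_erase, Set.Finite.mem_toFinset, Set.mem_inter_iff,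
          Metric.mem_closedBall, dist_eq_norm]
        tauto
      obtain ⟨T, hT, hTmin⟩ := (V.powerset.filter fun T => T.card < n).exists_min_image
        (fun T => ∏ μ ∈ T, ‖l - μ‖) ⟨∅, by simpa using hn⟩
      simp only [Finset.mem_filter, Finset.mem_powerset] at hT hTmin
      exact ⟨T, fun _ => ⟨hT.2, fun μ hμ => (hmem μ).1 (hT.1 hμ), fun T' hT' hTl =>
        hTmin T' ⟨fun μ hμ => (hmem μ).2 (hTl μ hμ), hT'⟩⟩⟩
    · exact ⟨∅, fun h => absurd h hl⟩
  choose T hT using hmin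
  refine ⟨T, fun l hl => ⟨fun μ hμ => ((hT l hl).2.1 μ hμ).1, fun h => ((hT l hl).2.1 l h).2.1 rfl,
    (hT l hl).1, fun μ hμ => ((hT l hl).2.1 μ hμ).2.2.trans_lt ?_⟩, fun M hM w hw => ?_⟩
  · rw [Real.exp_lt_exp]
    nlinarith [hψ.one_le l (hΛ hl)]
  refine ⟨M + n * (K + 1) + n, by positivity, fun s hs hsn => ?_⟩
  have hnn : ∀ i ∈ s, 0 ≤ ψ i := fun i hi => zero_le_one.trans (hψ.one_le i (hΛ (hs hi)))
  obtain ⟨a, ha⟩ : s.Nonempty := by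
    rw [← Finset.card_pos]
    omega
  have hsum : 1 ≤ ∑ i ∈ s, ψ i :=
    (hψ.one_le a (hΛ (hs ha))).trans (Finset.single_le_sum hnn ha)
  have hterm : ∀ i ∈ s, ‖w i‖ * ∏ k ∈ s.erase i, ‖i - k‖⁻¹ ≤
      Real.exp ((M + n * (K + 1)) * ∑ i ∈ s, ψ i) := by
    intro i hi
    have hiΛ := hs hi
    have hψi := hψ.one_le i (hΛ hiΛ)
    set A := (s.erase i).filter fun k => ‖k - i‖ ≤ Real.exp (-(K + 1) * ψ i) with hA
    set A' := (s.erase i).filter fun k => ¬ ‖k - i‖ ≤ Real.exp (-(K + 1) * ψ i) with hA'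
    -- The close points of s compete with T(i) in the minimisation, so their product cancels against
    -- the bound on w; each far point costs at most exp((K + 1)ψ(i)).
    have hle : ∏ μ ∈ T i, ‖i - μ‖ ≤ ∏ μ ∈ A, ‖i - μ‖ := by
      refine (hT i hiΛ).2.2 A ?_ fun μ hμ => ?_
      · refine (Finset.card_le_card (Finset.filter_subset _ _)).trans_lt ?_
        rw [Finset.card_erase_of_mem hi]
        omega
      · simp only [hA, Finset.mem_filter, Finset.mem_erase] at hμ
        exact ⟨hs hμ.1.2, hμ.1.1, hμ.2⟩
    have hApos : 0 < ∏ μ ∈ A, ‖i - μ‖ := Finset.prod_pos fun μ hμ => by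
      simp only [hA, Finset.mem_filter, Finset.mem_erase] at hμ
      exact norm_pos_iff.2 (sub_ne_zero.2 hμ.1.1.symm)
    have hA'le : ∏ k ∈ A', ‖i - k‖⁻¹ ≤ Real.exp (n * (K + 1) * ψ i) := by
      have h1 : ∏ k ∈ A', ‖i - k‖⁻¹ ≤ Real.exp ((K + 1) * ψ i) ^ A'.card := by
        rw [← Finset.prod_const]
        refine Finset.prod_le_prod (fun _ _ => by positivity) fun k hk => ?_
        simp only [hA', Finset.mem_filter, not_le] at hk
        refine inv_le_of_inv_le₀ (Real.exp_pos _) ?_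
        rw [← Real.exp_neg, ← neg_mul, norm_sub_rev]
        exact hk.2.le
      refine h1.trans ?_
      rw [← Real.exp_nat_mul, mul_assoc]
      have h2 : A'.card ≤ n := (Finset.card_le_card (Finset.filter_subset _ _)).trans
        ((Finset.card_le_card (Finset.erase_subset _ _)).trans hsn.le)
      gcongr
    rw [← Finset.prod_filter_mul_prod_filter_not (s.erase i)
      (fun k => ‖k - i‖ ≤ Real.exp (-(K + 1) * ψ i)), ← hA, ← hA', Finset.prod_inv_distrib (s := A)]
    calc ‖w i‖ * ((∏ k ∈ A, ‖i - k‖)⁻¹ * ∏ k ∈ A', ‖i - k‖⁻¹)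
        ≤ (Real.exp (M * ψ i) * ∏ μ ∈ A, ‖i - μ‖) *
            ((∏ k ∈ A, ‖i - k‖)⁻¹ * Real.exp (n * (K + 1) * ψ i)) := by
          have : 0 ≤ ∏ k ∈ A', ‖i - k‖⁻¹ := Finset.prod_nonneg fun _ _ => by positivity
          have h3 : ‖w i‖ ≤ Real.exp (M * ψ i) * ∏ μ ∈ A, ‖i - μ‖ :=
            (hw i hiΛ).trans (by gcongr)
          gcongr
      _ = Real.exp ((M + n * (K + 1)) * ψ i) := by
          rw [add_mul, Real.exp_add]
          field_simp
      _ ≤ _ := by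
          gcongr
          exact Finset.single_le_sum hnn hi
  refine (norm_finsetDividedDiff_le_sum w s).trans ((Finset.sum_le_card_nsmul s _ _ hterm).trans ?_)
  rw [hsn, nsmul_eq_mul, add_mul _ (n : ℝ), Real.exp_add, mul_comm]
  gcongr
  have := Real.add_one_le_exp (n * ∑ i ∈ s, ψ i)
  nlinarith [(Nat.cast_nonneg n : (0 : ℝ) ≤ n)]

/-- Interpolate the product of |l - μ| over T(l) at l and 0 elsewhere on Λ. The divided difference
at l, m and T(l) then has modulus exactly 1/|l - m|, and growth bounds it. -/
theorem exists_separation_of_nearest (hψ : IsDiskGauge ψ K D) (hΛ : Λ ⊆ 𝔻) {T : ℂ → Finset ℂ}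
    (hT : ∀ l ∈ Λ, ↑(T l) ⊆ Λ ∧ l ∉ T l ∧ (T l).card < n ∧
      ∀ μ ∈ T l, ‖μ - l‖ < Real.exp (-K * ψ l)) {N : ℝ} (hN : 0 ≤ N)
    (h : ∀ w : ℂ → ℂ, (∀ l ∈ Λ, ‖w l‖ ≤ ∏ μ ∈ T l, ‖l - μ‖) →
      ∃ f, HasDiskGrowth ψ N f ∧ ∀ l ∈ Λ, f l = w l) :
    ∃ C : ℝ, 0 ≤ C ∧ ∀ l ∈ Λ, ∀ m ∈ Λ, m ≠ l → m ∉ T l → Real.exp (-C * ψ l) ≤ ‖l - m‖ := by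
  classical
  have hK := hψ.pos
  have hD := hψ.one_le_const
  obtain ⟨B, hB, hBf⟩ : ∃ B : ℝ, 0 ≤ B ∧ ∀ f, HasDiskGrowth ψ N f → ∀ s : Finset ℂ, ↑s ⊆ 𝔻 →
      s.card ≤ n + 1 → ‖finsetDividedDiff f s‖ ≤ Real.exp (B * ∑ i ∈ s, ψ i) := by
    choose B hB hBf using hψ.norm_finsetDividedDiff_le hN
    refine ⟨∑ k ∈ Finset.range (n + 2), B k, Finset.sum_nonneg fun k _ => hB k,
      fun f hf s hs hsn => ?_⟩
    have h1 := hBf s.card 1 zero_le_one f hf.1 (by simpa using hf.2) s hs rfl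
    rw [one_mul] at h1
    refine h1.trans ?_
    have hsum : 0 ≤ ∑ i ∈ s, ψ i :=
      Finset.sum_nonneg fun i hi => zero_le_one.trans (hψ.one_le i (hs hi))
    gcongr
    exact Finset.single_le_sum (fun k _ => hB k) (Finset.mem_range.2 (by omega))
  refine ⟨K + B * (1 + D + n * D), by positivity, fun l hl m hm hml hmT => ?_⟩
  have hψl := hψ.one_le l (hΛ hl)
  obtain ⟨hTΛ, hlT, hTn, hTl⟩ := hT l hl
  rcases lt_or_ge ‖m - l‖ (Real.exp (-K * ψ l)) with hlt | hge
  · obtain ⟨f, hf, hfw⟩ := h (fun z => if z = l then ((∏ μ ∈ T l, ‖l - μ‖ : ℝ) : ℂ) else 0)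
      fun z _ => by
        split_ifs with hz
        · rw [Complex.norm_real, Real.norm_eq_abs,
            abs_of_nonneg (Finset.prod_nonneg fun _ _ => norm_nonneg _), hz]
        · simpa using Finset.prod_nonneg fun _ _ => norm_nonneg _
    have hfl := hfw l hl
    rw [if_pos rfl] at hfl
    have hf0 : ∀ z ∈ Λ, z ≠ l → f z = 0 := fun z hz hzl => by rw [hfw z hz, if_neg hzl]
    have hlmT : l ∉ insert m (T l) := by simp [hml.symm, hlT]
    have hsub : ↑(insert l (insert m (T l))) ⊆ Λ := by
      rw [Finset.coe_insert, Finset.coe_insert, Set.insert_subset_iff, Set.insert_subset_iff]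
      exact ⟨hl, hm, hTΛ⟩
    have hdd := hBf f hf _ (hsub.trans hΛ) (by
      rw [Finset.card_insert_of_notMem hlmT, Finset.card_insert_of_notMem hmT]
      omega)
    rw [finsetDividedDiff_insert_of_eq_zero hlmT (fun i hi => hf0 i
      (hsub (Finset.mem_coe.2 (Finset.mem_insert_of_mem hi))) fun e => hlmT (e ▸ hi)),
      Finset.prod_insert hmT, hfl, norm_mul, norm_mul, norm_prod, Complex.norm_real,
      Real.norm_eq_abs, abs_of_nonneg (Finset.prod_nonneg fun _ _ => norm_nonneg _)] at hdd
    simp only [norm_inv] at hdd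
    have hprod : ∏ μ ∈ T l, ‖l - μ‖ ≠ 0 := Finset.prod_ne_zero_iff.2 fun μ hμ =>
      norm_ne_zero_iff.2 (sub_ne_zero.2 fun e => hlT (e ▸ hμ))
    rw [Finset.prod_inv_distrib, mul_left_comm, mul_inv_cancel₀ hprod, mul_one,
      Finset.sum_insert hlmT, Finset.sum_insert hmT] at hdd
    have h1 : ∑ μ ∈ T l, ψ μ ≤ n * (D * ψ l) := by
      have h2 : ∀ μ ∈ T l, ψ μ ≤ D * ψ l := fun μ hμ =>
        hψ.le_mul l (hΛ hl) μ (hΛ (hTΛ hμ)) (hTl μ hμ)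
      refine (Finset.sum_le_card_nsmul _ _ _ h2).trans ?_
      rw [nsmul_eq_mul]
      gcongr
    have h3 : ψ m ≤ D * ψ l := hψ.le_mul l (hΛ hl) m (hΛ hm) hlt
    have hpos : 0 < ‖l - m‖ := norm_pos_iff.2 (sub_ne_zero.2 hml.symm)
    rw [neg_mul, Real.exp_neg, inv_le_comm₀ (Real.exp_pos _) hpos]
    refine hdd.trans (Real.exp_le_exp.2 ?_)
    have h4 : B * (ψ l + (ψ m + ∑ μ ∈ T l, ψ μ)) ≤ B * (ψ l + (D * ψ l + n * (D * ψ l))) := by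
      gcongr
    have h5 : 0 ≤ K * ψ l := by positivity
    linarith
  · rw [norm_sub_rev]
    refine le_trans ?_ hge
    rw [Real.exp_le_exp]
    have : 0 ≤ B * (1 + D + n * D) * ψ l := by positivity
    linarith

/-- Take a peak at l vanishing on the rest of Λ and divide out its zeros in T(l) \ Γ. The factors of
the peak value from T(l) ∩ Γ are bounded below by separation, so the quotient is large at l, still
vanishes on Γ \ {l}, and can be normalised and summed over l. -/
theorem isGaugeInterpolating_of_nearest (hψ : IsDiskGauge ψ K D) (hΛ : Λ ⊆ 𝔻) {T : ℂ → Finset ℂ}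
    (hT : ∀ l ∈ Λ, ↑(T l) ⊆ Λ ∧ l ∉ T l ∧ (T l).card < n ∧
      ∀ μ ∈ T l, ‖μ - l‖ < Real.exp (-K * ψ l))
    (h : ∀ M : ℝ, 0 ≤ M → ∃ N : ℝ, 0 ≤ N ∧ ∀ w : ℂ → ℂ,
      (∀ l ∈ Λ, ‖w l‖ ≤ Real.exp (M * ψ l) * ∏ μ ∈ T l, ‖l - μ‖) →
        ∃ f, HasDiskGrowth ψ N f ∧ ∀ l ∈ Λ, f l = w l)
    {Γ : Set ℂ} (hΓ : Γ ⊆ Λ) {C : ℝ} (hC : 0 ≤ C) (hsep : IsGaugeSeparated ψ C Γ) :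
    IsGaugeInterpolating ψ Γ := by
  classical
  have hK := hψ.pos
  have hD := hψ.one_le_const
  rintro w ⟨B, hB⟩
  -- The summands pay in turn for the data, the separated factors, the division by zeros, and
  -- summability. M must be fixed before N, which is possible because the division loss does not
  -- involve N.
  set M := |B| + n * C + (K + 1) * (n * D) + 2 * C with hM
  have hM0 : 0 ≤ M := by positivity
  obtain ⟨N, hN, hunif⟩ := h M hM0
  have hG : ∀ l : Γ, ∃ G : ℂ → ℂ, DifferentiableOn ℂ G 𝔻 ∧
      (∀ z ∈ 𝔻, ‖G z‖ ≤ Real.exp (N * D ^ (2 * n) * ψ z) * Real.exp (-(2 * C) * ψ l)) ∧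
      G l = w l ∧ ∀ m ∈ Γ, m ≠ l → G m = 0 := by
    rintro ⟨l, hl⟩
    have hlΛ := hΓ hl
    have hψl := hψ.one_le l (hΛ hlΛ)
    obtain ⟨hTΛ, hlT, hTn, hTl⟩ := hT l hlΛ
    have hprod0 : 0 ≤ ∏ μ ∈ T l, ‖l - μ‖ := Finset.prod_nonneg fun _ _ => norm_nonneg _
    obtain ⟨f, hf, hfw⟩ := hunif
      (fun z => if z = l then ((Real.exp (M * ψ l) * ∏ μ ∈ T l, ‖l - μ‖ : ℝ) : ℂ) else 0)
      fun z _ => by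
        split_ifs with hz
        · rw [Complex.norm_real, Real.norm_eq_abs, abs_of_nonneg (by positivity), hz]
        · rw [norm_zero]
          exact mul_nonneg (Real.exp_pos _).le (Finset.prod_nonneg fun _ _ => norm_nonneg _)
    have hfl := hfw l hlΛ
    rw [if_pos rfl] at hfl
    have hf0 : ∀ z ∈ Λ, z ≠ l → f z = 0 := fun z hz hzl => by rw [hfw z hz, if_neg hzl]
    set t := (T l).filter fun μ => ¬ μ ∈ Γ with ht
    have htT : t ⊆ T l := Finset.filter_subset _ _
    have htΛ : ↑t ⊆ Λ := (Finset.coe_subset.2 htT).trans hTΛ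
    have htn : t.card ≤ n := (Finset.card_le_card htT).trans hTn.le
    obtain ⟨g, hg, hfg, hgb⟩ := hψ.exists_eq_mul_prod_sub (htΛ.trans hΛ) zero_le_one hN hf.1
      (by simpa using hf.2) fun μ hμ => hf0 μ (htΛ hμ) fun e => hlT (htT (e ▸ hμ))
    have hgl : Real.exp ((M - n * C) * ψ l) ≤ ‖g l‖ := by
      have h1 := hfg l
      rw [hfl] at h1
      have h2 := congrArg norm h1
      rw [Complex.norm_real, Real.norm_eq_abs, abs_of_nonneg (by positivity), norm_mul, norm_prod,
        ← Finset.prod_filter_mul_prod_filter_not (T l) (fun μ => μ ∈ Γ), ← ht, ← mul_assoc] at h2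
      have h3 : ∏ μ ∈ t, ‖l - μ‖ ≠ 0 := Finset.prod_ne_zero_iff.2 fun μ hμ =>
        norm_ne_zero_iff.2 (sub_ne_zero.2 fun e => hlT (htT (e ▸ hμ)))
      rw [← mul_right_cancel₀ h3 h2, sub_mul, sub_eq_add_neg, Real.exp_add]
      gcongr
      have h4 : ∏ _μ ∈ (T l).filter fun μ => μ ∈ Γ, Real.exp (-C * ψ l) ≤
          ∏ μ ∈ (T l).filter fun μ => μ ∈ Γ, ‖l - μ‖ := by
        refine Finset.prod_le_prod (fun _ _ => (Real.exp_pos _).le) fun μ hμ => ?_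
        rw [Finset.mem_filter] at hμ
        exact hsep l hl μ hμ.2 fun e => hlT (e ▸ hμ.1)
      refine le_trans ?_ h4
      rw [Finset.prod_const, ← Real.exp_nat_mul, Real.exp_le_exp]
      have h5 : (((T l).filter fun μ => μ ∈ Γ).card : ℝ) ≤ n := by
        exact_mod_cast (Finset.card_le_card (Finset.filter_subset _ _)).trans hTn.le
      have h6 : 0 ≤ C * ψ l := by positivity
      nlinarith
    have hgpos : 0 < ‖g l‖ := (Real.exp_pos _).trans_le hgl
    refine ⟨fun z => w l * (g l)⁻¹ * g z, hg.const_mul _, fun z hz => ?_, ?_, fun m hm hml => ?_⟩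
    · have hψz := hψ.one_le z hz
      rw [norm_mul, norm_mul, norm_inv]
      have h1 : ‖w l‖ ≤ Real.exp (|B| * ψ l) := (hB l hl).trans (by
        gcongr
        exact le_abs_self B)
      have h2 : ‖g l‖⁻¹ ≤ Real.exp (-((M - n * C) * ψ l)) := by
        rw [Real.exp_neg]
        gcongr
      have h3 : ∑ μ ∈ t, ψ μ ≤ n * (D * ψ l) := by
        have h4 : ∀ μ ∈ t, ψ μ ≤ D * ψ l := fun μ hμ =>
          hψ.le_mul l (hΛ hlΛ) μ (hΛ (htΛ hμ)) (hTl μ (htT hμ))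
        refine (Finset.sum_le_card_nsmul _ _ _ h4).trans ?_
        rw [nsmul_eq_mul]
        gcongr
      have h5 : ‖g z‖ ≤ Real.exp ((K + 1) * (n * (D * ψ l))) *
          Real.exp (N * D ^ (2 * n) * ψ z) := by
        refine (hgb z hz).trans ?_
        rw [one_mul]
        gcongr
      calc ‖w l‖ * ‖g l‖⁻¹ * ‖g z‖ ≤ Real.exp (|B| * ψ l) * Real.exp (-((M - n * C) * ψ l)) *
            (Real.exp ((K + 1) * (n * (D * ψ l))) * Real.exp (N * D ^ (2 * n) * ψ z)) := by
            gcongr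
        _ = _ := by
            rw [← Real.exp_add, ← Real.exp_add, ← Real.exp_add, ← Real.exp_add, hM]
            ring_nf
    · simp only
      rw [mul_assoc, inv_mul_cancel₀ (norm_pos_iff.1 hgpos), mul_one]
    · have h1 := hfg m
      rw [hf0 m (hΓ hm) hml] at h1
      have h2 : ∏ μ ∈ t, (m - μ) ≠ 0 := Finset.prod_ne_zero_iff.2 fun μ hμ =>
        sub_ne_zero.2 fun e => (Finset.mem_filter.1 hμ).2 (e ▸ hm)
      simp only [(mul_eq_zero.1 h1.symm).resolve_right h2, mul_zero]
  choose G hGd hGb hGl hG0 using hG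
  obtain ⟨N', hN'⟩ := hψ.exists_hasDiskGrowth_tsum (by positivity)
    (hψ.summable_of_isGaugeSeparated (hΓ.trans hΛ) hC hsep) hGd hGb
  refine ⟨N', _, hN', fun l hl => ?_⟩
  rw [tsum_eq_single ⟨l, hl⟩ fun m hm => hG0 m l hl fun e => hm (Subtype.ext e.symm)]
  exact hGl ⟨l, hl⟩

theorem exists_iUnion_isGaugeInterpolating (hψ : IsDiskGauge ψ K D) (hΛ : Λ ⊆ 𝔻)
    (hcount : Λ.Countable)
    (hfin : ∀ a ∈ 𝔻, (Λ ∩ Metric.closedBall a (Real.exp (-(K + 1) * ψ a))).Finite)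
    (hn : 0 < n) (hX : ∀ w, HasDividedDiffGrowth ψ Λ n w →
      ∃ N f, HasDiskGrowth ψ N f ∧ ∀ l ∈ Λ, f l = w l) :
    ∃ S : Fin n → Set ℂ, (∀ j, S j ⊆ Λ ∧ IsGaugeInterpolating ψ (S j)) ∧ Λ = ⋃ j, S j := by
  classical
  have hD := hψ.one_le_const
  have hK := hψ.pos
  obtain ⟨T, hT, hTX⟩ := hψ.exists_nearest_hasDividedDiffGrowth hΛ hfin hn
  have hunif : ∀ M : ℝ, 0 ≤ M → ∃ N : ℝ, 0 ≤ N ∧ ∀ w : ℂ → ℂ,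
      (∀ l ∈ Λ, ‖w l‖ ≤ Real.exp (M * ψ l) * ∏ μ ∈ T l, ‖l - μ‖) →
        ∃ f, HasDiskGrowth ψ N f ∧ ∀ l ∈ Λ, f l = w l := fun M hM =>
    hψ.exists_uniform_interpolation hΛ
      (fun l _ => mul_nonneg (Real.exp_pos _).le (Finset.prod_nonneg fun _ _ => norm_nonneg _))
      fun w hw => hX w (hTX M hM w hw)
  obtain ⟨N, hN, hN0⟩ := hunif 0 le_rfl
  obtain ⟨C, hC, hsep⟩ := hψ.exists_separation_of_nearest hΛ hT hN (by simpa using hN0)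
  have : Countable Λ := hcount
  -- Closeness is required at both scales to make the relation symmetric; `hsep` places the
  -- neighbours of l in T(l), which has fewer than n points.
  obtain ⟨c, hc⟩ := exists_greedy_coloring (α := Λ) hn
    (fun l m => l ≠ m ∧ ‖(l : ℂ) - m‖ < Real.exp (-C * ψ l) ∧
      ‖(l : ℂ) - m‖ < Real.exp (-C * ψ m))
    (fun l m h => ⟨h.1.symm, by rw [norm_sub_rev]; exact h.2.2, by rw [norm_sub_rev]; exact h.2.1⟩)
    (fun l h => h.1 rfl) (fun l => (T l).subtype (· ∈ Λ))
    (fun l => by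
      rw [Finset.card_subtype]
      exact (Finset.card_le_card (Finset.filter_subset _ _)).trans_lt (hT l l.2).2.2.1)
    (fun l m h => by
      rw [Finset.mem_subtype]
      by_contra hm
      exact absurd h.2.1 (not_lt.2 (hsep l l.2 m m.2 (fun e => h.1 (Subtype.ext e.symm)) hm)))
  refine ⟨fun j => {z | ∃ hz : z ∈ Λ, c ⟨z, hz⟩ = j}, fun j => ⟨fun z hz => hz.1, ?_⟩, ?_⟩
  · refine hψ.isGaugeInterpolating_of_nearest hΛ hT hunif (fun z hz => hz.1)
      (C := K + C * D) (by positivity) ?_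
    rintro l ⟨hl, hlj⟩ m ⟨hm, hmj⟩ hlm
    have hψl := hψ.one_le l (hΛ hl)
    have hCl : 0 ≤ C * ψ l := by positivity
    by_contra hlt
    rw [not_le] at hlt
    have h1 : ‖m - l‖ < Real.exp (-K * ψ l) := by
      rw [norm_sub_rev]
      refine hlt.trans_le (Real.exp_le_exp.2 ?_)
      have : 0 ≤ C * D * ψ l := by positivity
      linarith
    have h2 := hψ.le_mul l (hΛ hl) m (hΛ hm) h1
    refine hc ⟨l, hl⟩ ⟨m, hm⟩ ⟨fun e => hlm (congrArg Subtype.val e), hlt.trans_le ?_,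
      hlt.trans_le ?_⟩ (hlj.trans hmj.symm)
    · rw [Real.exp_le_exp]
      have : C * ψ l ≤ D * (C * ψ l) := le_mul_of_one_le_left hCl hD
      have : 0 ≤ K * ψ l := by positivity
      linarith
    · rw [Real.exp_le_exp]
      have : C * ψ m ≤ C * (D * ψ l) := by gcongr
      have : 0 ≤ K * ψ l := by positivity
      linarith
  · ext z
    simp

end IsDiskGauge

/-! ### Passage between weights and gauges -/

theorem IsDiskDiscrete.finite_inter {Λ : Set ℂ} (hΛ : IsDiskDiscrete Λ) {V : Set ℂ}
    (hV : IsCompact V) (hV𝔻 : V ⊆ 𝔻) : (Λ ∩ V).Finite := by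
  by_contra hinf
  obtain ⟨a, ha, hacc⟩ := Set.Infinite.exists_accPt_of_subset_isCompact hinf hV
    Set.inter_subset_right
  exact hΛ.2 a (hV𝔻 ha) (hacc.mono (Filter.principal_mono.2 Set.inter_subset_left))

theorem IsDiskDiscrete.countable {Λ : Set ℂ} (hΛ : IsDiskDiscrete Λ) : Λ.Countable := by
  have h : Λ ⊆ ⋃ k : ℕ, Λ ∩ Metric.closedBall 0 (1 - 1 / (k + 1 : ℝ)) := by
    intro z hz
    have hz1 : 0 < 1 - ‖z‖ := by simpa using hΛ.1 hz
    obtain ⟨k, hk⟩ := exists_nat_one_div_lt hz1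
    refine Set.mem_iUnion.2 ⟨k, hz, ?_⟩
    rw [Metric.mem_closedBall, dist_zero_right]
    linarith
  refine (Set.countable_iUnion fun k => ?_).mono h
  refine (hΛ.finite_inter (isCompact_closedBall _ _) ?_).countable
  refine Metric.closedBall_subset_ball ?_
  have : (0 : ℝ) < 1 / (k + 1 : ℝ) := by positivity
  linarith

theorem IsDiskDiscrete.mono {Λ Γ : Set ℂ} (hΛ : IsDiskDiscrete Λ) (h : Γ ⊆ Λ) :
    IsDiskDiscrete Γ :=
  ⟨h.trans hΛ.1, fun z hz hacc => hΛ.2 z hz (hacc.mono (Filter.principal_mono.2 h))⟩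

/-- The two quotients differ by the factor 1 - conj λ₁ λ_{j+1}, which is at least 1 - |λ₁| in
modulus. -/
theorem norm_dividedDiff_le_norm_hypDividedDiff {ψ : ℂ → ℝ} {K D : ℝ} (hψ : IsDiskGauge ψ K D)
    {Λ : Set ℂ} (hΛ : Λ ⊆ 𝔻) (ω : Λ → ℂ) (j : ℕ) (v : Fin (j + 1) → Λ) :
    ‖dividedDiff ω j v‖ ≤ ‖hypDividedDiff ω j v‖ * Real.exp (K * ψ (v 0)) := by
  have h0 := hψ.one_le _ (hΛ (v 0).2)
  have hK := hψ.pos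
  cases j with
  | zero =>
    rw [dividedDiff, hypDividedDiff]
    exact le_mul_of_one_le_right (norm_nonneg _) (Real.one_le_exp (by positivity))
  | succ j =>
    rw [dividedDiff, hypDividedDiff, ← div_mul, norm_mul, mul_assoc]
    refine le_mul_of_one_le_right (norm_nonneg _) ?_
    have h1 := hψ.exp_le_norm_one_sub_conj_mul (hΛ (v 0).2) (hΛ (v (Fin.last (j + 1))).2)
    have h2 := mul_le_mul_of_nonneg_right h1 (Real.exp_pos (K * ψ (v 0))).le
    rwa [← Real.exp_add, neg_mul, neg_add_cancel, Real.exp_zero] at h2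

theorem norm_hypDividedDiff_le_norm_dividedDiff {Λ : Set ℂ} (hΛ : Λ ⊆ 𝔻) (ω : Λ → ℂ) (j : ℕ)
    (v : Fin (j + 1) → Λ) : ‖hypDividedDiff ω j v‖ ≤ 2 * ‖dividedDiff ω j v‖ := by
  cases j with
  | zero =>
    rw [dividedDiff, hypDividedDiff]
    linarith [norm_nonneg (ω (v 0))]
  | succ j =>
    rw [dividedDiff, hypDividedDiff, ← div_mul, norm_mul, mul_comm]
    gcongr
    have h1 : ‖(v 0 : ℂ)‖ < 1 := by simpa using hΛ (v 0).2
    have h2 : ‖(v (Fin.last (j + 1)) : ℂ)‖ < 1 := by simpa using hΛ (v (Fin.last (j + 1))).2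
    refine (norm_sub_le _ _).trans ?_
    rw [norm_one, norm_mul, RCLike.norm_conj]
    nlinarith [norm_nonneg (v 0 : ℂ), norm_nonneg (v (Fin.last (j + 1)) : ℂ)]

namespace IsDiskWeight

variable {φ : ℂ → ℝ}

theorem mem_korenblumAlgebra_iff (hφ : IsDiskWeight φ) {f : ℂ → ℂ} :
    f ∈ korenblumAlgebra φ ↔ ∃ N, HasDiskGrowth (fun z => φ z + 1) N f := by
  constructor
  · rintro ⟨hf, B, hB, A, hA⟩
    refine ⟨B + |A|, hf, fun z hz => ?_⟩
    have h0 := hφ.nonneg z hz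
    have h1 := hA z hz
    rw [neg_mul, Real.exp_neg, ← div_eq_mul_inv, div_le_iff₀ (Real.exp_pos _)] at h1
    have h2 : A ≤ Real.exp |A| := by linarith [le_abs_self A, Real.add_one_le_exp |A|]
    calc ‖f z‖ ≤ Real.exp |A| * Real.exp (B * φ z) := h1.trans (by gcongr)
      _ ≤ _ := by
        rw [← Real.exp_add, Real.exp_le_exp]
        have : 0 ≤ |A| * φ z := by positivity
        linarith
  · rintro ⟨N, hf, hN⟩
    refine ⟨hf, |N| + 1, by positivity, Real.exp |N|, fun z hz => ?_⟩
    have h0 := hφ.nonneg z hz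
    calc ‖f z‖ * Real.exp (-(|N| + 1) * φ z)
        ≤ Real.exp (|N| * (φ z + 1)) * Real.exp (-(|N| + 1) * φ z) := by
          gcongr
          refine (hN z hz).trans ?_
          gcongr
          exact le_abs_self N
      _ ≤ _ := by
          rw [← Real.exp_add, Real.exp_le_exp]
          linarith

theorem mem_diskTrace_iff (hφ : IsDiskWeight φ) {Λ : Set ℂ} {ω : Λ → ℂ} {w : ℂ → ℂ}
    (hw : ∀ l : Λ, w l = ω l) :
    ω ∈ diskTrace φ Λ ↔ ∃ N f, HasDiskGrowth (fun z => φ z + 1) N f ∧ ∀ l ∈ Λ, f l = w l := by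
  constructor
  · rintro ⟨f, hf, hfω⟩
    obtain ⟨N, hN⟩ := hφ.mem_korenblumAlgebra_iff.1 hf
    exact ⟨N, f, hN, fun l hl => (hfω ⟨l, hl⟩).trans (hw ⟨l, hl⟩).symm⟩
  · rintro ⟨N, f, hf, hfw⟩
    exact ⟨f, hφ.mem_korenblumAlgebra_iff.2 ⟨N, hf⟩, fun l => (hfw l l.2).trans (hw l)⟩

theorem mem_growthSpace_iff (hφ : IsDiskWeight φ) {Λ : Set ℂ} (hΛ : Λ ⊆ 𝔻) {ω : Λ → ℂ} :
    ω ∈ growthSpace φ Λ ↔ ∃ B : ℝ, ∀ l : Λ, ‖ω l‖ ≤ Real.exp (B * (φ l + 1)) := by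
  constructor
  · rintro ⟨A, B, hA, hB, h⟩
    refine ⟨B + A, fun l => (h l).trans ?_⟩
    have h0 := hφ.nonneg l (hΛ l.2)
    calc A * Real.exp (B * φ l) ≤ Real.exp A * Real.exp (B * φ l) := by
          gcongr
          linarith [Real.add_one_le_exp A]
      _ ≤ _ := by
        rw [← Real.exp_add, Real.exp_le_exp]
        have : 0 ≤ A * φ l := by positivity
        linarith
  · rintro ⟨B, h⟩
    refine ⟨Real.exp B, |B| + 1, Real.exp_pos _, by positivity, fun l => (h l).trans ?_⟩
    have h0 := hφ.nonneg l (hΛ l.2)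
    rw [← Real.exp_add, Real.exp_le_exp]
    have : B * φ l ≤ (|B| + 1) * φ l := by
      gcongr
      linarith [le_abs_self B]
    linarith

theorem isDiskInterpolating_iff (hφ : IsDiskWeight φ) {Γ : Set ℂ} (hΓ : IsDiskDiscrete Γ) :
    IsDiskInterpolating φ Γ ↔ IsGaugeInterpolating (fun z => φ z + 1) Γ := by
  classical
  constructor
  · rintro ⟨-, h⟩ w ⟨B, hB⟩
    have hw := h (fun l => w l) ((hφ.mem_growthSpace_iff hΓ.1).2 ⟨B, fun l => hB l l.2⟩)
    exact (hφ.mem_diskTrace_iff fun _ => rfl).1 hw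
  · refine fun h => ⟨hΓ, fun ω hω => ?_⟩
    obtain ⟨B, hB⟩ := (hφ.mem_growthSpace_iff hΓ.1).1 hω
    set w : ℂ → ℂ := fun z => if hz : z ∈ Γ then ω ⟨z, hz⟩ else 0 with hwdef
    have hw : ∀ l : Γ, w l = ω l := fun l => by simp [hwdef]
    refine (hφ.mem_diskTrace_iff hw).2 (h w ⟨B, fun l hl => ?_⟩)
    have := hB ⟨l, hl⟩
    rwa [← hw ⟨l, hl⟩] at this

theorem mem_hypDiffSpace_iff (hφ : IsDiskWeight φ) {Λ : Set ℂ} (hΛ : Λ ⊆ 𝔻) {ω : Λ → ℂ} {w : ℂ → ℂ}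
    (hw : ∀ l : Λ, w l = ω l) (j : ℕ) :
    ω ∈ hypDiffSpace φ Λ j ↔ HasDividedDiffGrowth (fun z => φ z + 1) Λ (j + 1) w := by
  classical
  obtain ⟨K, D, hψ⟩ := hφ.exists_isDiskGauge
  have hK := hψ.pos
  constructor
  · rintro ⟨B, hB, A, hA⟩
    refine ⟨|A| + B + K, by positivity, fun s hs hsj => ?_⟩
    let e := s.equivFinOfCardEq hsj
    let v : Fin (j + 1) → Λ := fun i => ⟨e.symm i, hs (e.symm i).2⟩
    have hv : Function.Injective v := fun a b h =>
      e.symm.injective (Subtype.ext (congrArg (fun x : Λ => (x : ℂ)) h))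
    have himg : (Finset.univ.image fun i => (v i : ℂ)) = s := by
      ext x
      simp only [Finset.mem_image, Finset.mem_univ, true_and]
      constructor
      · rintro ⟨i, rfl⟩
        exact (e.symm i).2
      · intro hx
        exact ⟨e ⟨x, hx⟩, by simp [v]⟩
    have hsumv : ∑ i, φ (v i) = ∑ x ∈ s, φ x := by
      rw [← himg, Finset.sum_image fun a _ b _ h => hv (Subtype.ext h)]
    have h1 := hA v hv
    rw [hsumv, neg_mul, Real.exp_neg, ← div_eq_mul_inv, div_le_iff₀ (Real.exp_pos _)] at h1
    have h2 := norm_dividedDiff_le_norm_hypDividedDiff hψ hΛ ω j v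
    rw [dividedDiff_eq_finsetDividedDiff hw j v hv, himg] at h2
    have hnn : ∀ i ∈ s, 0 ≤ φ i + 1 := fun i hi => zero_le_one.trans (hψ.one_le i (hΛ (hs hi)))
    have h0s : (v 0 : ℂ) ∈ s := (e.symm 0).2
    have h3 : φ (v 0) + 1 ≤ ∑ x ∈ s, (φ x + 1) := Finset.single_le_sum hnn h0s
    have h4 : 1 ≤ ∑ x ∈ s, (φ x + 1) := (hψ.one_le _ (hΛ (v 0).2)).trans h3
    have h5 : ∑ x ∈ s, φ x ≤ ∑ x ∈ s, (φ x + 1) := Finset.sum_le_sum fun _ _ => by linarith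
    have h6 : A ≤ Real.exp (|A| * ∑ x ∈ s, (φ x + 1)) := by
      have := Real.add_one_le_exp (|A| * ∑ x ∈ s, (φ x + 1))
      nlinarith [le_abs_self A, abs_nonneg A]
    calc ‖finsetDividedDiff w s‖ ≤ ‖hypDividedDiff ω j v‖ * Real.exp (K * (φ (v 0) + 1)) := h2
      _ ≤ (Real.exp (|A| * ∑ x ∈ s, (φ x + 1)) * Real.exp (B * ∑ x ∈ s, (φ x + 1))) *
          Real.exp (K * ∑ x ∈ s, (φ x + 1)) := by
        have h7 : ‖hypDividedDiff ω j v‖ ≤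
            Real.exp (|A| * ∑ x ∈ s, (φ x + 1)) * Real.exp (B * ∑ x ∈ s, (φ x + 1)) :=
          h1.trans (by gcongr)
        gcongr
      _ = _ := by
        rw [← Real.exp_add, ← Real.exp_add]
        ring_nf
  · rintro ⟨B, hB, h⟩
    refine ⟨B + 1, by positivity, 2 * Real.exp (B * (j + 1)), fun v hv => ?_⟩
    set s : Finset ℂ := Finset.univ.image fun i => (v i : ℂ) with hs
    have hinj : Function.Injective fun i => (v i : ℂ) := Subtype.val_injective.comp hv
    have hsΛ : ↑s ⊆ Λ := by
      intro x hx
      simp only [hs, Finset.coe_image, Set.mem_image] at hx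
      obtain ⟨i, -, rfl⟩ := hx
      exact (v i).2
    have h1 := h s hsΛ (by rw [hs, Finset.card_image_of_injective _ hinj, Finset.card_fin])
    rw [hs, Finset.sum_image fun a _ b _ h => hinj h, ← dividedDiff_eq_finsetDividedDiff hw j v hv,
      Finset.sum_add_distrib] at h1
    simp only [Finset.sum_const, Finset.card_univ, Fintype.card_fin, nsmul_eq_mul, mul_one] at h1
    have h0 : 0 ≤ ∑ i, φ (v i) := Finset.sum_nonneg fun i _ => hφ.nonneg _ (hΛ (v i).2)
    calc ‖hypDividedDiff ω j v‖ * Real.exp (-(B + 1) * ∑ i, φ (v i))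
        ≤ (2 * Real.exp (B * (∑ i, φ (v i) + (j + 1 : ℕ)))) *
            Real.exp (-(B + 1) * ∑ i, φ (v i)) := by
          gcongr
          exact (norm_hypDividedDiff_le_norm_dividedDiff hΛ ω j v).trans (by gcongr)
      _ ≤ _ := by
          rw [mul_assoc, ← Real.exp_add]
          gcongr
          push_cast
          linarith

end IsDiskWeight

/-! ### The main theorem -/

theorem mainTheorem2 (φ : ℂ → ℝ) (hφ : IsDiskWeight φ) (Λ : Set ℂ) (hΛ : IsDiskDiscrete Λ)
    (n : ℕ) (hn : 1 ≤ n) :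
    diskTrace φ Λ = hypDiffSpace φ Λ (n - 1) ↔
      ∃ S : Fin n → Set ℂ, (∀ j, IsDiskInterpolating φ (S j)) ∧ Λ = ⋃ j, S j := by
  classical
  obtain ⟨K, D, hψ⟩ := hφ.exists_isDiskGauge
  have hspace : ∀ {ω : Λ → ℂ} {w : ℂ → ℂ}, (∀ l : Λ, w l = ω l) →
      (ω ∈ hypDiffSpace φ Λ (n - 1) ↔ HasDividedDiffGrowth (fun z => φ z + 1) Λ n w) := by
    intro ω w hw
    rw [hφ.mem_hypDiffSpace_iff hΛ.1 hw, Nat.sub_add_cancel hn]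
  constructor
  · intro heq
    obtain ⟨S, hS, hΛS⟩ := hψ.exists_iUnion_isGaugeInterpolating hΛ.1 hΛ.countable
      (fun a ha => hΛ.finite_inter (isCompact_closedBall _ _) fun z hz =>
        hψ.mem_of_norm_sub_lt ha (by
          rw [Metric.mem_closedBall, dist_eq_norm] at hz
          refine hz.trans_lt (Real.exp_lt_exp.2 ?_)
          have := hψ.one_le a ha
          linarith)) hn (fun w hw => by
        have hw' := (hspace (ω := fun l => w l) fun _ => rfl).2 hw
        rw [← heq] at hw'
        exact (hφ.mem_diskTrace_iff fun _ => rfl).1 hw')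
    exact ⟨S, fun j => (hφ.isDiskInterpolating_iff (hΛ.mono (hS j).1)).2 (hS j).2, hΛS⟩
  · rintro ⟨S, hS, hΛS⟩
    ext ω
    have hw : ∀ l : Λ, (fun z => if hz : z ∈ Λ then ω ⟨z, hz⟩ else 0) (l : ℂ) = ω l := fun l => by
      simp
    set w : ℂ → ℂ := fun z => if hz : z ∈ Λ then ω ⟨z, hz⟩ else 0
    rw [hφ.mem_diskTrace_iff hw, hspace hw]
    constructor
    · rintro ⟨N, f, hf, hfw⟩
      obtain ⟨B, hB, h⟩ := hψ.hasDividedDiffGrowth (le_max_right N 0)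
        (hf.mono hψ (le_max_left N 0)) hΛ.1 n
      refine ⟨B, hB, fun s hs hsn => ?_⟩
      rw [← finsetDividedDiff_congr fun i hi => hfw i (hs hi)]
      exact h s hs hsn
    · intro hwX
      -- Padding by empty sets gives a sequence, which `disjointed` makes pairwise disjoint; subsets
      -- of interpolating sets stay interpolating.
      set S' : ℕ → Set ℂ := fun i => if hi : i < n then S ⟨i, hi⟩ else ∅ with hS'
      have hS'Λ : ∀ i, S' i ⊆ Λ := fun i => by
        simp only [hS']
        split_ifs with hi
        · rw [hΛS]
          exact Set.subset_iUnion S _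
        · exact Set.empty_subset _
      have hS'int : ∀ i, IsGaugeInterpolating (fun z => φ z + 1) (S' i) := fun i => by
        simp only [hS']
        split_ifs with hi
        · exact (hφ.isDiskInterpolating_iff (hS _).1).1 (hS _)
        · exact fun _ _ => ⟨0, 0, HasDiskGrowth.zero _ 0, by simp⟩
      have hcover : ∀ l ∈ Λ, ∃ i < n, l ∈ disjointed S' i := by
        intro l hl
        have hl' : l ∈ ⋃ i, disjointed S' i := by
          rw [iUnion_disjointed]
          rw [hΛS] at hl
          obtain ⟨j, hj⟩ := Set.mem_iUnion.1 hl
          exact Set.mem_iUnion.2 ⟨j, by simpa [hS'] using hj⟩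
        obtain ⟨i, hi⟩ := Set.mem_iUnion.1 hl'
        refine ⟨i, ?_, hi⟩
        by_contra hin
        have := disjointed_subset S' i hi
        simp [hS', hin] at this
      obtain ⟨N, f, hf, hfw⟩ := hψ.exists_interpolation_iUnion (S := disjointed S')
        (fun i => ((disjointed_subset S' i).trans (hS'Λ i)).trans hΛ.1)
        (fun i => (hS'int i).mono (disjointed_subset S' i)) (disjoint_disjointed S') n w
        (hwX.mono fun z ⟨i, _, hz⟩ => hS'Λ i (disjointed_subset S' i hz))
      refine ⟨N, f, hf, fun l hl => ?_⟩
      obtain ⟨i, hi, hli⟩ := hcover l hl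
      exact hfw i hi l hli
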